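/- Let $g$ be a real-valued strongly additive function on the positive integers, i.e. $g(mn)=g(m)+g(n)$ whenever $\gcd(m,n)=1$, and $g(p^k)=g(p)$ for all primes $p$ and integers $k\ge 1$. For $n\ge 2$ let $\rho_n$ be the probability measure on $\mathbb{R}$ given by $$\rho_n(A)=\frac{\sum_{p\le n,\ g(p)\in A}\frac1p}{\sum_{p\le n}\frac1p}\qquad (A\subset\mathbb{R}\text{ Borel}),$$ where the sums run over primes $p$. Assume that there is a probability measure $\rho$ on $\mathbb{R}$ such that, for every $\theta\in\mathbb{R}$, $\int_{\mathbb{R}} e^{\theta y}\,\rho(dy)<\infty$ and $\int_{\mathbb{R}} e^{\theta y}\,\rho_n(dy)\to\int_{\mathbb{R}} e^{\theta y}\,\rho(dy)$ as $n\to\infty$. Let $V(n)$ be uniformly distributed on $\{1,2,\dots,n\}$ and let $X(n)=g(V(n))$. Then the laws of $X(n)/\log\log n$ satisfy the large deviation principle with speed $\log\log n$ and rate function $$I(x)=\sup_{\theta\in\mathbb{R}}\left\{\theta x-\int_{\mathbb{R}}(e^{\theta y}-1)\,\rho(dy)\right\}\in[0,\infty].$$ That is, $I:\mathbb{R}\to[0,\infty]$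 is lower semicontinuous, and for every Borel set $A\subset\mathbb{R}$ with interior $A^{o}$ and closure $\overline{A}$, $$-\inf_{x\in A^{o}}I(x)\le\liminf_{n\to\infty}\frac{1}{\log\log n}\log\mathbb{P}\left(\frac{X(n)}{\log\log n}\in A\right)\le\limsup_{n\to\infty}\frac{1}{\log\log n}\log\mathbb{P}\left(\frac{X(n)}{\log\log n}\in A\right)\le-\inf_{x\in\overline{A}}I(x),$$ where $\log 0=-\infty$ and $\inf\emptyset=+\infty$. -/

import Mathlib

open MeasureTheory ProbabilityTheory Filter Topology

noncomputable section

/-- A strongly additive arithmetic function. Only its values at positive integers matter. -/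
structure IsStronglyAdditive (g : ℕ → ℝ) : Prop where
  map_prime_pow : ∀ p k : ℕ, p.Prime → 1 ≤ k → g (p ^ k) = g p
  map_mul_of_coprime : ∀ m n : ℕ, 0 < m → 0 < n → Nat.Coprime m n → g (m * n) = g m + g n

/-- The primes `p ≤ n`. -/
def primesUpTo (n : ℕ) : Finset ℕ := {p ∈ Finset.Icc 1 n | p.Prime}

/-- The empirical law of `g p`, where the prime `p ≤ n` has weight proportional to `1 / p`:
`A ↦ (∑_{p ≤ n, g p ∈ A} 1 / p) / (∑_{p ≤ n} 1 / p)`.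
It is a probability measure for `n ≥ 2`. -/
def primeEmpiricalLaw (g : ℕ → ℝ) (n : ℕ) : Measure ℝ :=
  (∑ p ∈ primesUpTo n, (p : ENNReal)⁻¹)⁻¹ •
    ∑ p ∈ primesUpTo n, (p : ENNReal)⁻¹ • Measure.dirac (g p)

/-- The law of `g (V n) / log (log n)`, where `V n` is uniform on `{1, …, n}`. -/
def scaledLaw (g : ℕ → ℝ) (n : ℕ) : Measure ℝ :=
  (uniformOn (Set.Icc 1 n)).map (fun v : ℕ => g v / Real.log (Real.log n))

/-- The large deviation principle for the measures `P n`, with speed `b n` and rate function `I`,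
which may take the value `+∞`. Here `log 0 = -∞`, and the infimum over the empty set is `+∞`. -/
structure SatisfiesLDP {X : Type*} [TopologicalSpace X] [MeasurableSpace X]
    (P : ℕ → Measure X) (b : ℕ → ℝ) (I : X → EReal) : Prop where
  nonneg : ∀ x, 0 ≤ I x
  lowerSemicontinuous : LowerSemicontinuous I
  lower_bound : ∀ A : Set X, MeasurableSet A →
    -(⨅ x ∈ interior A, I x) ≤
      liminf (fun n => ((1 / b n : ℝ) : EReal) * ENNReal.log (P n A)) atTop
  upper_bound : ∀ A : Set X, MeasurableSet A →
    limsup (fun n => ((1 / b n : ℝ) : EReal) * ENNReal.log (P n A)) atTop ≤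
      -(⨅ x ∈ closure A, I x)

/-- The function `I x = sup_θ (θ x - ∫ (exp (θ y) - 1) ρ(dy))`, with values in `[-∞, ∞]`. -/
def rateFunction (ρ : Measure ℝ) (x : ℝ) : EReal :=
  ⨆ θ : ℝ, ((θ * x - ∫ y, (Real.exp (θ * y) - 1) ∂ρ : ℝ) : EReal)

end

/-! Write L = log log n and let V be uniform on {1, …, n}. By the Gärtner–Ellis theorem
(`satisfiesLDP_of_tendsto_cgf`) it is enough that L⁻¹ log E exp(θ g(V)) → Λ(θ) = ∫ (e^{θy} - 1) dρ
for every θ; here Λ is finite and differentiable everywhere, and the mean of ρ is a subgradient of Λ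
at 0.

Strong additivity makes g(V) the sum of g(p) over the primes p dividing V. Divisibility by distinct
primes is nearly independent, with probability about 1/p, so the moment should resemble ∏_{p ≤ n} (1
+ (e^{θ g(p)} - 1)/p). The logarithm of this product is ∑ (e^{θ g(p)} - 1)/p + o(L), which is Λ(θ) L
+ o(L) by the hypothesis and Mertens' theorem ∑ 1/p ~ L.

Independence is only justified for primes up to y = exp(log n / L²), where Rankin's trick bounds the
error by exp(-L² + O(L)) (`eventually_abs_dvdProductMean_sub_prod_le`). Since log log y ~ L, the
primes in (y, n] carry only o(L) of each sum, and a crude upper bound (`dvdProductMean_le_exp`)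
keeps their exponential moments below exp(o(L)) at every tilt. Hölder's inequality with exponent
close to 1 joins the two ranges (`tendsto_logMeanExp_div_log_log`), and continuity of the moment
generating function of ρ removes the loss. -/

noncomputable section

/-! ### Legendre transforms and logarithms of measures -/

/-- A real function with subgradient `m` at `0` attains, up to a small error in the slope, every
point at which its Legendre transform is finite. -/
theorem exists_hasDerivAt_near_of_legendre_le {Λ : ℝ → ℝ} {m : ℝ} (hd : Differentiable ℝ Λ)
    (h0 : Λ 0 = 0) (htan : ∀ θ, m * θ ≤ Λ θ) {x r : ℝ} (hr : ∀ θ, θ * x - Λ θ ≤ r)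
    {η : ℝ} (hη : 0 < η) :
    ∃ θ, |deriv Λ θ - x| < η ∧ θ * deriv Λ θ - Λ θ ≤ r := by
  have hr0 : 0 ≤ r := by simpa [h0] using hr 0
  -- At the maximiser of `φ` below, (εθ)² = 2ε · (εθ²/2) ≤ 2εr, and this must stay below η².
  obtain ⟨ε, hε, hεr⟩ : ∃ ε : ℝ, 0 < ε ∧ 2 * ε * r < η ^ 2 := by
    refine ⟨η ^ 2 / (2 * (r + 1)), by positivity, ?_⟩
    have : 2 * (η ^ 2 / (2 * (r + 1))) * r = η ^ 2 * (r / (r + 1)) := by field_simp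
    rw [this]
    have h1 : r / (r + 1) < 1 := by rw [div_lt_one (by linarith)]; linarith
    nlinarith [sq_pos_of_pos hη]
  -- The supremum of θx - Λ(θ) need not be attained. The quadratic penalty beats the linear upper
  -- bound θ(x - m), so a maximiser exists; the price is a shift of the slope by εθ.
  set φ : ℝ → ℝ := fun θ => θ * x - Λ θ - ε * θ ^ 2 / 2 with hφ
  have hφc : Continuous φ := by
    have := hd.continuous
    fun_prop
  obtain ⟨θ, hθ⟩ : ∃ θ, ∀ t, φ t ≤ φ θ := by
    refine hφc.exists_forall_ge' 0 ?_
    have hev : ∀ᶠ t : ℝ in cocompact ℝ, 2 * |x - m| / ε < ‖t‖ :=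
      tendsto_norm_cocompact_atTop.eventually_gt_atTop _
    filter_upwards [hev] with t ht
    rw [div_lt_iff₀ hε, Real.norm_eq_abs] at ht
    have h1 : t * (x - m) ≤ |t| * |x - m| := by
      rw [← abs_mul]; exact le_abs_self _
    have h2 : |t| * |x - m| ≤ |t| * (|t| * ε / 2) :=
      mul_le_mul_of_nonneg_left (by linarith) (abs_nonneg t)
    have h3 : |t| * |t| = t ^ 2 := by rw [← sq, sq_abs]
    have h4 := htan t
    simp only [hφ, h0]
    nlinarith
  have hder : HasDerivAt φ (x - deriv Λ θ - ε * θ) θ := by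
    have h1 := ((hasDerivAt_id θ).mul_const x).sub (hd θ).hasDerivAt
    have h2 := (((hasDerivAt_id θ).pow 2).const_mul ε).div_const 2
    refine (h1.sub h2).congr_deriv ?_
    simp; ring
  have hz : x - deriv Λ θ - ε * θ = 0 :=
    IsLocalMax.hasDerivAt_eq_zero (Eventually.of_forall hθ) hder
  have hpos : 0 ≤ φ θ := by simpa [hφ, h0] using hθ 0
  have hbd := hr θ
  simp only [hφ] at hpos
  have hslope : deriv Λ θ = x - ε * θ := by linarith
  refine ⟨θ, ?_, ?_⟩
  · rw [hslope]
    have : |x - ε * θ - x| = |ε * θ| := by rw [← abs_neg]; congr 1; ring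
    rw [this]
    refine abs_lt_of_sq_lt_sq ?_ hη.le
    have : (ε * θ) ^ 2 = 2 * ε * (ε * θ ^ 2 / 2) := by ring
    rw [this]
    refine lt_of_le_of_lt ?_ hεr
    exact mul_le_mul_of_nonneg_left (by linarith) (by positivity)
  · rw [hslope]
    have : 0 ≤ ε * θ ^ 2 := by positivity
    nlinarith

theorem mul_log_measure_le_of_real_le {μ : Measure ℝ} [IsFiniteMeasure μ] {A : Set ℝ} {b c : ℝ}
    (hb : 0 < b) (h : μ.real A ≤ Real.exp (b * c)) :
    ((1 / b : ℝ) : EReal) * ENNReal.log (μ A) ≤ (c : EReal) := by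
  have h1 : μ A ≤ ENNReal.ofReal (Real.exp (b * c)) := by
    rw [← ofReal_measureReal]
    exact ENNReal.ofReal_le_ofReal h
  have h2 : ENNReal.log (μ A) ≤ ((b * c : ℝ) : EReal) := by
    refine (ENNReal.log_le_log h1).trans ?_
    rw [ENNReal.log_ofReal_of_pos (Real.exp_pos _), Real.log_exp]
  calc _ ≤ ((1 / b : ℝ) : EReal) * ((b * c : ℝ) : EReal) :=
        mul_le_mul_of_nonneg_left h2 (by exact_mod_cast (by positivity : (0 : ℝ) ≤ 1 / b))
    _ = c := by
        rw [← EReal.coe_mul]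
        congr 1
        field_simp

theorem le_mul_log_measure_of_le_real {μ : Measure ℝ} [IsFiniteMeasure μ] {A : Set ℝ} {b c : ℝ}
    (hb : 0 < b) (h : Real.exp (b * c) ≤ μ.real A) :
    (c : EReal) ≤ ((1 / b : ℝ) : EReal) * ENNReal.log (μ A) := by
  have h1 : ENNReal.ofReal (Real.exp (b * c)) ≤ μ A := by
    rw [← ofReal_measureReal (μ := μ)]
    exact ENNReal.ofReal_le_ofReal h
  have h2 : ((b * c : ℝ) : EReal) ≤ ENNReal.log (μ A) := by
    refine le_trans ?_ (ENNReal.log_le_log h1)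
    rw [ENNReal.log_ofReal_of_pos (Real.exp_pos _), Real.log_exp]
  calc (c : EReal) = ((1 / b : ℝ) : EReal) * ((b * c : ℝ) : EReal) := by
        rw [← EReal.coe_mul]
        congr 1
        field_simp
    _ ≤ _ := mul_le_mul_of_nonneg_left h2 (by exact_mod_cast (by positivity : (0 : ℝ) ≤ 1 / b))

/-! ### The Gärtner–Ellis theorem on the line -/

section GartnerEllis

variable {P : ℕ → Measure ℝ} {b : ℕ → ℝ} {Λ : ℝ → ℝ} {m : ℝ}

/-- Chernoff's bound with tilt `b n * θ`; the gap in `hα` absorbs the error in the convergence of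
the cumulants. -/
theorem eventually_measureReal_Ici_le (hP : ∀ᶠ n in atTop, IsProbabilityMeasure (P n))
    (hb : Tendsto b atTop atTop)
    (hint : ∀ n t, Integrable (fun x : ℝ => Real.exp (t * x)) (P n))
    (hlim : ∀ θ, Tendsto (fun n => cgf id (P n) (b n * θ) / b n) atTop (𝓝 (Λ θ)))
    {θ c α : ℝ} (hθ : 0 ≤ θ) (hα : α < θ * c - Λ θ) :
    ∀ᶠ n in atTop, (P n).real (Set.Ici c) ≤ Real.exp (b n * -α) := by
  filter_upwards [hP, hb.eventually_gt_atTop 0,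
    (hlim θ).eventually_lt_const (show Λ θ < θ * c - α by linarith)] with n hn hbn hl
  rw [div_lt_iff₀ hbn] at hl
  refine (measure_ge_le_exp_cgf (X := id) (t := b n * θ) c (by positivity) (hint n _)).trans ?_
  exact Real.exp_le_exp.mpr (by nlinarith)

theorem eventually_measureReal_Iic_le (hP : ∀ᶠ n in atTop, IsProbabilityMeasure (P n))
    (hb : Tendsto b atTop atTop)
    (hint : ∀ n t, Integrable (fun x : ℝ => Real.exp (t * x)) (P n))
    (hlim : ∀ θ, Tendsto (fun n => cgf id (P n) (b n * θ) / b n) atTop (𝓝 (Λ θ)))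
    {θ c α : ℝ} (hθ : θ ≤ 0) (hα : α < θ * c - Λ θ) :
    ∀ᶠ n in atTop, (P n).real (Set.Iic c) ≤ Real.exp (b n * -α) := by
  filter_upwards [hP, hb.eventually_gt_atTop 0,
    (hlim θ).eventually_lt_const (show Λ θ < θ * c - α by linarith)] with n hn hbn hl
  rw [div_lt_iff₀ hbn] at hl
  refine (measure_le_le_exp_cgf (X := id) (t := b n * θ) c
    (mul_nonpos_of_nonneg_of_nonpos hbn.le hθ) (hint n _)).trans ?_
  exact Real.exp_le_exp.mpr (by nlinarith)

/-- The upper bound of the Gärtner–Ellis theorem, before taking logarithms. -/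
theorem eventually_measureReal_le_of_isClosed (hP : ∀ᶠ n in atTop, IsProbabilityMeasure (P n))
    (hb : Tendsto b atTop atTop)
    (hint : ∀ n t, Integrable (fun x : ℝ => Real.exp (t * x)) (P n))
    (htan : ∀ θ, m * θ ≤ Λ θ)
    (hlim : ∀ θ, Tendsto (fun n => cgf id (P n) (b n * θ) / b n) atTop (𝓝 (Λ θ)))
    {C : Set ℝ} (hC : IsClosed C) {α : ℝ}
    (hα : ∀ x ∈ C, ∃ θ, α < θ * x - Λ θ) :
    ∀ᶠ n in atTop, (P n).real C ≤ 2 * Real.exp (b n * -α) := by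
  -- For negative α the bound exceeds 1. For α ≥ 0 the tangent at 0 fixes the sign of the tilt: α <
  -- θc - Λ(θ) ≤ θ(c - m), so θ has the sign of c - m. One Chernoff bound at the point of `C`
  -- nearest to m then suffices on each side.
  rcases lt_or_ge α 0 with hneg | hα0
  · filter_upwards [hP, hb.eventually_gt_atTop 0] with n hn hbn
    have : 1 ≤ Real.exp (b n * -α) := Real.one_le_exp (by nlinarith)
    linarith [measureReal_le_one (μ := P n) (s := C)]
  have hright : ∀ᶠ n in atTop, (P n).real (C ∩ Set.Ici m) ≤ Real.exp (b n * -α) := by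
    rcases (C ∩ Set.Ici m).eq_empty_or_nonempty with he | hne
    · simp only [he, measureReal_empty]
      exact Eventually.of_forall fun n => (Real.exp_pos _).le
    have hbdd : BddBelow (C ∩ Set.Ici m) := ⟨m, fun x hx => hx.2⟩
    have hmem := (hC.inter isClosed_Ici).csInf_mem hne hbdd
    set c := sInf (C ∩ Set.Ici m)
    obtain ⟨θ, hθ⟩ := hα c hmem.1
    have hc : m ≤ c := hmem.2
    have hθ0 : 0 ≤ θ := by
      by_contra! h
      nlinarith [htan θ]
    filter_upwards [hP, eventually_measureReal_Ici_le hP hb hint hlim hθ0 hθ] with n hn h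
    exact (measureReal_mono fun x hx => csInf_le hbdd hx).trans h
  have hleft : ∀ᶠ n in atTop, (P n).real (C ∩ Set.Iic m) ≤ Real.exp (b n * -α) := by
    rcases (C ∩ Set.Iic m).eq_empty_or_nonempty with he | hne
    · simp only [he, measureReal_empty]
      exact Eventually.of_forall fun n => (Real.exp_pos _).le
    have hbdd : BddAbove (C ∩ Set.Iic m) := ⟨m, fun x hx => hx.2⟩
    have hmem := (hC.inter isClosed_Iic).csSup_mem hne hbdd
    set c := sSup (C ∩ Set.Iic m)
    obtain ⟨θ, hθ⟩ := hα c hmem.1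
    have hc : c ≤ m := hmem.2
    have hθ0 : θ ≤ 0 := by
      by_contra! h
      nlinarith [htan θ]
    filter_upwards [hP, eventually_measureReal_Iic_le hP hb hint hlim hθ0 hθ] with n hn h
    exact (measureReal_mono fun x hx => le_csSup hbdd hx).trans h
  filter_upwards [hP, hleft, hright] with n hn h1 h2
  have hsub : C ⊆ (C ∩ Set.Iic m) ∪ (C ∩ Set.Ici m) := fun x hx =>
    (le_total x m).imp (fun h => ⟨hx, h⟩) fun h => ⟨hx, h⟩
  have := (measureReal_mono hsub).trans (measureReal_union_le (μ := P n) _ _)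
  linarith

/-- Under the measure `P n` tilted by `b n * θ`, the half-line `{x | t * c ≤ t * x}` is negligible
if moving the tilt from `θ` to `θ + t` costs less than `t * c`. -/
theorem eventually_setIntegral_exp_le (hP : ∀ᶠ n in atTop, IsProbabilityMeasure (P n))
    (hb : Tendsto b atTop atTop)
    (hint : ∀ n t, Integrable (fun x : ℝ => Real.exp (t * x)) (P n))
    (hlim : ∀ θ, Tendsto (fun n => cgf id (P n) (b n * θ) / b n) atTop (𝓝 (Λ θ)))
    {θ t c : ℝ} (h : Λ (θ + t) - Λ θ < t * c) :
    ∀ᶠ n in atTop, ∫ x in {x | t * c ≤ t * x}, Real.exp (b n * θ * x) ∂P n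
      ≤ mgf id (P n) (b n * θ) / 4 := by
  set δ := t * c - (Λ (θ + t) - Λ θ) with hδ
  have hδ0 : 0 < δ := by linarith
  have hdiff := (hlim (θ + t)).sub (hlim θ)
  -- Half of the margin δ pays for the convergence of the cumulants, the other half for the factor
  -- 1/4, through log 4 ≤ b δ / 2.
  filter_upwards [hP, hb.eventually_gt_atTop 0, hb.eventually_ge_atTop (2 * Real.log 4 / δ),
    hdiff.eventually_lt_const (show Λ (θ + t) - Λ θ < t * c - δ / 2 by linarith)]
    with n hn hbn hbn' hl
  rw [← sub_div, div_lt_iff₀ hbn] at hl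
  rw [div_le_iff₀ hδ0] at hbn'
  have hpt : ∀ x ∈ {x | t * c ≤ t * x}, Real.exp (b n * θ * x) ≤
      Real.exp (-(b n * (t * c))) * Real.exp (b n * (θ + t) * x) := by
    intro x hx
    rw [← Real.exp_add]
    refine Real.exp_le_exp.mpr ?_
    have : b n * (t * c) ≤ b n * (t * x) := mul_le_mul_of_nonneg_left hx hbn.le
    nlinarith
  have hms : MeasurableSet {x : ℝ | t * c ≤ t * x} :=
    measurableSet_le measurable_const (by fun_prop)
  have hint2 : Integrable (fun x : ℝ =>
      Real.exp (-(b n * (t * c))) * Real.exp (b n * (θ + t) * x)) (P n) := (hint n _).const_mul _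
  calc ∫ x in {x | t * c ≤ t * x}, Real.exp (b n * θ * x) ∂P n
      ≤ ∫ x in {x | t * c ≤ t * x},
          Real.exp (-(b n * (t * c))) * Real.exp (b n * (θ + t) * x) ∂P n :=
        setIntegral_mono_on (hint n _).integrableOn hint2.integrableOn hms hpt
    _ ≤ ∫ x, Real.exp (-(b n * (t * c))) * Real.exp (b n * (θ + t) * x) ∂P n :=
        setIntegral_le_integral hint2 (Eventually.of_forall fun x => by positivity)
    _ = Real.exp (-(b n * (t * c))) * mgf id (P n) (b n * (θ + t)) := by
        rw [integral_const_mul]; rfl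
    _ = Real.exp (-(b n * (t * c)) + cgf id (P n) (b n * (θ + t))) := by
        rw [Real.exp_add, exp_cgf (X := id) (hint n _)]
    _ ≤ Real.exp (cgf id (P n) (b n * θ) - Real.log 4) := Real.exp_le_exp.mpr (by nlinarith)
    _ = mgf id (P n) (b n * θ) / 4 := by
        rw [Real.exp_sub, exp_cgf (X := id) (hint n _), Real.exp_log (by norm_num)]

/-- The lower bound of the Gärtner–Ellis theorem at an exposed point, before taking logarithms. -/
theorem eventually_le_measureReal_Ioo (hP : ∀ᶠ n in atTop, IsProbabilityMeasure (P n))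
    (hb : Tendsto b atTop atTop)
    (hint : ∀ n t, Integrable (fun x : ℝ => Real.exp (t * x)) (P n))
    (hlim : ∀ θ, Tendsto (fun n => cgf id (P n) (b n * θ) / b n) atTop (𝓝 (Λ θ)))
    {θ x η : ℝ} (hx : HasDerivAt Λ x θ) (hη : 0 < η) :
    ∀ᶠ n in atTop, Real.exp (b n * (Λ θ - θ * x - (|θ| + 1) * η)) ≤
      (P n).real (Set.Ioo (x - η) (x + η)) := by
  obtain ⟨s, hs, hup, hlo⟩ : ∃ s > 0, Λ (θ + s) - Λ θ < s * (x + η) ∧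
      Λ (θ + -s) - Λ θ < -s * (x - η) := by
    have h1 := hasDerivAt_iff_isLittleO_nhds_zero.mp hx
    have h2 := h1.def (show 0 < η / 2 by linarith)
    obtain ⟨ε, hε, hball⟩ := Metric.eventually_nhds_iff.mp h2
    have key : ∀ t : ℝ, |t| = ε / 2 → |Λ (θ + t) - Λ θ - t * x| ≤ η / 2 * (ε / 2) := by
      intro t ht
      have := hball (y := t) (by rw [Real.dist_eq, sub_zero, ht]; linarith)
      simpa [ht] using this
    have k1 := abs_le.mp (key (ε / 2) (abs_of_pos (by linarith)))
    have k2 := abs_le.mp (key (-(ε / 2)) (by rw [abs_neg]; exact abs_of_pos (by linarith)))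
    refine ⟨ε / 2, by linarith, ?_, ?_⟩ <;> nlinarith [mul_pos hε hη]
  filter_upwards [hP, hb.eventually_gt_atTop 0, hb.eventually_ge_atTop (2 * Real.log 2 / η),
    eventually_setIntegral_exp_le hP hb hint hlim hup,
    eventually_setIntegral_exp_le hP hb hint hlim hlo,
    (hlim θ).eventually_const_lt (show Λ θ - η / 2 < Λ θ by linarith)] with n hn hbn hbn' hu hl hc
  rw [lt_div_iff₀ hbn] at hc
  rw [div_le_iff₀ hη] at hbn'
  have eU : {y : ℝ | s * (x + η) ≤ s * y} = Set.Ici (x + η) := by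
    ext y; simp [mul_le_mul_iff_right₀ hs]
  have eL : {y : ℝ | -s * (x - η) ≤ -s * y} = Set.Iic (x - η) := by
    ext y; simp [mul_le_mul_iff_right₀ hs]
  rw [eU] at hu
  rw [eL] at hl
  set F : ℝ → ℝ := fun y => Real.exp (b n * θ * y) with hF
  have hFi : Integrable F (P n) := hint n _
  have hcompl : (Set.Ioo (x - η) (x + η))ᶜ = Set.Iic (x - η) ∪ Set.Ici (x + η) := by
    rw [← Set.Ioi_inter_Iio, Set.compl_inter, Set.compl_Ioi, Set.compl_Iio]
  -- Each half-line has at most a quarter of the tilted mass, so at least half of it lies in the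
  -- interval.
  have hout : ∫ y in (Set.Ioo (x - η) (x + η))ᶜ, F y ∂P n ≤ mgf id (P n) (b n * θ) / 2 := by
    have hdisj : Disjoint (Set.Iic (x - η)) (Set.Ici (x + η)) := by
      rw [Set.Iic_disjoint_Ici]
      linarith
    rw [hcompl, setIntegral_union hdisj measurableSet_Ici hFi.integrableOn hFi.integrableOn]
    linarith
  have hsum : ∫ y in Set.Ioo (x - η) (x + η), F y ∂P n + ∫ y in (Set.Ioo (x - η) (x + η))ᶜ, F y ∂P n
      = mgf id (P n) (b n * θ) := integral_add_compl measurableSet_Ioo hFi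
  have hin : ∫ y in Set.Ioo (x - η) (x + η), F y ∂P n ≤
      Real.exp (b n * (θ * x + |θ| * η)) * (P n).real (Set.Ioo (x - η) (x + η)) := by
    have hle : ∀ y ∈ Set.Ioo (x - η) (x + η), F y ≤ Real.exp (b n * (θ * x + |θ| * η)) := by
      intro y hy
      refine Real.exp_le_exp.mpr ?_
      rw [mul_assoc]
      refine mul_le_mul_of_nonneg_left ?_ hbn.le
      have h1 : |y - x| ≤ η := abs_le.mpr ⟨by linarith [hy.1], by linarith [hy.2]⟩
      have h2 : θ * (y - x) ≤ |θ| * |y - x| := by rw [← abs_mul]; exact le_abs_self _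
      nlinarith [mul_le_mul_of_nonneg_left h1 (abs_nonneg θ)]
    calc _ ≤ ∫ y in Set.Ioo (x - η) (x + η), Real.exp (b n * (θ * x + |θ| * η)) ∂P n :=
          setIntegral_mono_on hFi.integrableOn (integrable_const _).integrableOn
            measurableSet_Ioo hle
      _ = _ := by rw [setIntegral_const, smul_eq_mul, mul_comm]
  have hmain : Real.exp (cgf id (P n) (b n * θ)) / 2 ≤
      Real.exp (b n * (θ * x + |θ| * η)) * (P n).real (Set.Ioo (x - η) (x + η)) := by
    rw [exp_cgf (X := id) (hint n _)]
    linarith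
  have h2 : Real.exp (cgf id (P n) (b n * θ)) / 2 =
      Real.exp (cgf id (P n) (b n * θ) - Real.log 2) := by
    rw [Real.exp_sub, Real.exp_log (by norm_num)]
  rw [h2, ← div_le_iff₀' (Real.exp_pos _), ← Real.exp_sub] at hmain
  refine le_trans (Real.exp_le_exp.mpr ?_) hmain
  nlinarith

/-- The **Gärtner–Ellis theorem** on the real line, for a limiting cumulant generating function
that is finite and differentiable everywhere and has a subgradient at `0`. -/
theorem satisfiesLDP_of_tendsto_cgf (hP : ∀ᶠ n in atTop, IsProbabilityMeasure (P n))
    (hb : Tendsto b atTop atTop)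
    (hint : ∀ n t, Integrable (fun x : ℝ => Real.exp (t * x)) (P n))
    (h0 : Λ 0 = 0) (hd : Differentiable ℝ Λ) (htan : ∀ θ, m * θ ≤ Λ θ)
    (hlim : ∀ θ, Tendsto (fun n => cgf id (P n) (b n * θ) / b n) atTop (𝓝 (Λ θ))) :
    SatisfiesLDP P b (fun x => ⨆ θ : ℝ, ((θ * x - Λ θ : ℝ) : EReal)) where
  nonneg x := by
    refine le_iSup_of_le 0 ?_
    simp [h0]
  lowerSemicontinuous := by
    refine lowerSemicontinuous_iSup fun θ => Continuous.lowerSemicontinuous ?_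
    exact continuous_coe_real_ereal.comp (by fun_prop)
  lower_bound A _ := by
    rw [← EReal.ge_of_forall_gt_iff_ge]
    intro z hz
    have hz' : (⨅ x ∈ interior A, ⨆ θ : ℝ, ((θ * x - Λ θ : ℝ) : EReal)) < ((-z : ℝ) : EReal) := by
      rw [EReal.coe_neg]
      exact EReal.lt_neg_comm.mp hz
    simp only [iInf_lt_iff] at hz'
    obtain ⟨x, hxA, hxz⟩ := hz'
    have hr : ∀ θ, θ * x - Λ θ ≤ -z := fun θ => by
      exact_mod_cast (le_iSup (fun θ : ℝ => ((θ * x - Λ θ : ℝ) : EReal)) θ).trans hxz.le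
    obtain ⟨η, hη, hball⟩ := Metric.isOpen_iff.mp isOpen_interior x hxA
    obtain ⟨θ, hθ1, hθ2⟩ := exists_hasDerivAt_near_of_legendre_le hd h0 htan hr hη
    -- The exposed point Λ'(θ) only approximates x, so a new radius around it is needed; `κ` is then
    -- small enough for the loss (|θ| + 1)κ to fit between w and z.
    obtain ⟨ζ, hζ, hball'⟩ := Metric.isOpen_iff.mp isOpen_interior (deriv Λ θ)
      (hball (by simpa [Real.dist_eq] using hθ1))
    rw [← EReal.ge_of_forall_gt_iff_ge]
    intro w hw
    have hw' : w < z := by exact_mod_cast hw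
    set κ := min ζ ((z - w) / (|θ| + 1)) with hκ
    have hpos : 0 < |θ| + 1 := by positivity
    have hκ0 : 0 < κ := lt_min hζ (div_pos (by linarith) hpos)
    have hκ1 : (|θ| + 1) * κ ≤ z - w := by
      have := min_le_right ζ ((z - w) / (|θ| + 1))
      rw [← hκ, le_div_iff₀ hpos] at this
      linarith
    refine le_liminf_of_le (by isBoundedDefault) ?_
    filter_upwards [hP, hb.eventually_gt_atTop 0,
      eventually_le_measureReal_Ioo hP hb hint hlim (hd θ).hasDerivAt hκ0] with n hn hbn hm
    refine le_mul_log_measure_of_le_real hbn ?_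
    refine le_trans (le_trans ?_ hm) (measureReal_mono ?_)
    · exact Real.exp_le_exp.mpr (mul_le_mul_of_nonneg_left (by linarith) hbn.le)
    · refine Set.Subset.trans ?_ (hball'.trans interior_subset)
      rw [Real.ball_eq_Ioo]
      exact Set.Ioo_subset_Ioo (by linarith [min_le_left ζ ((z - w) / (|θ| + 1))])
        (by linarith [min_le_left ζ ((z - w) / (|θ| + 1))])
  upper_bound A _ := by
    rw [← EReal.le_of_forall_lt_iff_le]
    intro z hz
    have hz' : ((-z : ℝ) : EReal) < ⨅ x ∈ closure A, ⨆ θ : ℝ, ((θ * x - Λ θ : ℝ) : EReal) := by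
      rw [EReal.coe_neg]
      exact EReal.neg_lt_comm.mp hz
    have hα : ∀ x ∈ closure A, ∃ θ, -z < θ * x - Λ θ := by
      intro x hx
      have h1 := hz'.trans_le (iInf₂_le x hx)
      obtain ⟨θ, hθ⟩ := lt_iSup_iff.mp h1
      exact ⟨θ, by exact_mod_cast hθ⟩
    rw [← EReal.le_of_forall_lt_iff_le]
    intro w hw
    have hw' : z < w := by exact_mod_cast hw
    refine limsup_le_of_le (by isBoundedDefault) ?_
    filter_upwards [hP, hb.eventually_gt_atTop 0,
      hb.eventually_ge_atTop (Real.log 2 / (w - z)),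
      eventually_measureReal_le_of_isClosed hP hb hint htan hlim isClosed_closure hα]
      with n hn hbn hbn' hm
    rw [div_le_iff₀ (by linarith)] at hbn'
    refine mul_log_measure_le_of_real_le hbn ?_
    refine (measureReal_mono subset_closure).trans (hm.trans ?_)
    rw [neg_neg]
    calc 2 * Real.exp (b n * z) = Real.exp (Real.log 2 + b n * z) := by
          rw [Real.exp_add, Real.exp_log (by norm_num)]
      _ ≤ _ := Real.exp_le_exp.mpr (by nlinarith)

end GartnerEllis

/-! ### Finite Euler products and Mertens' second theorem -/

theorem prime_of_mem_primesUpTo {n p : ℕ} (hp : p ∈ primesUpTo n) : p.Prime :=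
  (Finset.mem_filter.mp hp).2

theorem le_of_mem_primesUpTo {n p : ℕ} (hp : p ∈ primesUpTo n) : p ≤ n :=
  (Finset.mem_Icc.mp (Finset.mem_filter.mp hp).1).2

theorem mem_primesUpTo {n p : ℕ} : p ∈ primesUpTo n ↔ p ≤ n ∧ p.Prime := by
  simp only [primesUpTo, Finset.mem_filter, Finset.mem_Icc]
  exact ⟨fun h => ⟨h.1.2, h.2⟩, fun h => ⟨⟨h.2.one_le, h.1⟩, h.2⟩⟩

theorem mem_factoredNumbers_primesUpTo {n v : ℕ} (hv : v ∈ Finset.Icc 1 n) :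
    v ∈ Nat.factoredNumbers (primesUpTo n) := by
  have h := Finset.mem_Icc.mp hv
  rw [Nat.mem_factoredNumbers']
  intro p hp hd
  exact mem_primesUpTo.mpr ⟨(Nat.le_of_dvd h.1 hd).trans h.2, hp⟩

/-- The completely multiplicative function `m ↦ m ^ (-s)`. -/
def natRpowNegHom (s : ℝ) : ℕ →* ℝ where
  toFun m := (m : ℝ) ^ (-s)
  map_one' := by simp
  map_mul' a b := by
    push_cast
    exact Real.mul_rpow (Nat.cast_nonneg a) (Nat.cast_nonneg b)

theorem norm_natRpowNegHom_lt_one {s : ℝ} (hs : 0 < s) {p : ℕ} (hp : p.Prime) :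
    ‖natRpowNegHom s p‖ < 1 := by
  have h1 : (1 : ℝ) < p := by exact_mod_cast hp.one_lt
  change ‖(p : ℝ) ^ (-s)‖ < 1
  rw [Real.norm_of_nonneg (by positivity)]
  exact Real.rpow_lt_one_of_one_lt_of_neg h1 (by linarith)

/-- Only finitely many primes occur, so the Euler product is valid for all s > 0, in particular at s
= 1. -/
theorem hasSum_factoredNumbers_primesUpTo {s : ℝ} (hs : 0 < s) (n : ℕ) :
    HasSum (fun m : Nat.factoredNumbers (primesUpTo n) => ((m : ℕ) : ℝ) ^ (-s))
      (∏ p ∈ primesUpTo n, (1 - (p : ℝ) ^ (-s))⁻¹) := by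
  have h := (EulerProduct.summable_and_hasSum_factoredNumbers_prod_filter_prime_geometric
    (f := natRpowNegHom s) (fun hp => norm_natRpowNegHom_lt_one hs hp) (primesUpTo n)).2
  rwa [Finset.filter_true_of_mem fun p hp => prime_of_mem_primesUpTo hp] at h

/-- Every v ≤ n has all its prime factors up to n, so the harmonic sum is a subsum of the expanded
product. -/
theorem log_le_prod_primesUpTo (n : ℕ) :
    Real.log n ≤ ∏ p ∈ primesUpTo n, (1 - (p : ℝ)⁻¹)⁻¹ := by
  have h := hasSum_factoredNumbers_primesUpTo one_pos n
  simp only [Real.rpow_neg_one] at h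
  have h1 : ∑ v ∈ Finset.Icc 1 n, (v : ℝ)⁻¹ ≤ ∏ p ∈ primesUpTo n, (1 - (p : ℝ)⁻¹)⁻¹ := by
    have h2 := h.summable.sum_le_tsum
      (Finset.univ.image fun v : Finset.Icc 1 n =>
        (⟨v, mem_factoredNumbers_primesUpTo v.2⟩ : Nat.factoredNumbers (primesUpTo n)))
      fun m _ => by positivity
    rw [h.tsum_eq, Finset.sum_image fun a _ b _ hab => Subtype.ext (by simpa using hab)] at h2
    rwa [← Finset.sum_coe_sort (Finset.Icc 1 n) fun v : ℕ => (v : ℝ)⁻¹]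
  have h3 : ((harmonic n : ℚ) : ℝ) = ∑ v ∈ Finset.Icc 1 n, (v : ℝ)⁻¹ := by
    rw [harmonic_eq_sum_Icc]
    push_cast
    rfl
  rcases Nat.eq_zero_or_pos n with rfl | hn
  · simp [primesUpTo]
  have h4 : Real.log n ≤ Real.log ((n + 1 : ℕ) : ℝ) :=
    Real.log_le_log (by exact_mod_cast hn) (by push_cast; linarith)
  linarith [log_add_one_le_harmonic n]

theorem inv_one_sub_le_exp {u : ℝ} (hu : u ≤ 1 / 2) :
    (1 - u)⁻¹ ≤ Real.exp (u + 2 * u ^ 2) := by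
  have h1 : (0 : ℝ) < 1 - u := by linarith
  have h2 : (1 - u)⁻¹ ≤ u + 2 * u ^ 2 + 1 := by
    rw [inv_le_iff_one_le_mul₀' h1]
    nlinarith [mul_nonneg (sq_nonneg u) (show (0 : ℝ) ≤ 1 - 2 * u by linarith)]
  exact h2.trans (Real.add_one_le_exp _)

theorem exists_log_log_sub_le_sum_inv :
    ∃ C : ℝ, ∀ n : ℕ, 2 ≤ n → Real.log (Real.log n) - C ≤ ∑ p ∈ primesUpTo n, (p : ℝ)⁻¹ := by
  have hsum : Summable fun m : ℕ => ((m : ℝ) ^ 2)⁻¹ := Real.summable_nat_pow_inv.mpr one_lt_two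
  refine ⟨2 * ∑' m : ℕ, ((m : ℝ) ^ 2)⁻¹, fun n hn => ?_⟩
  have hlog : 0 < Real.log n := Real.log_pos (by exact_mod_cast hn)
  have h1 : Real.log n ≤ Real.exp (∑ p ∈ primesUpTo n, ((p : ℝ)⁻¹ + 2 * ((p : ℝ)⁻¹) ^ 2)) := by
    rw [Real.exp_sum]
    have hhalf : ∀ p ∈ primesUpTo n, (p : ℝ)⁻¹ ≤ 1 / 2 := fun p hp => by
      rw [inv_eq_one_div]
      exact one_div_le_one_div_of_le two_pos
        (by exact_mod_cast (prime_of_mem_primesUpTo hp).two_le)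
    refine (log_le_prod_primesUpTo n).trans (Finset.prod_le_prod ?_ ?_)
    · intro p hp
      have := hhalf p hp
      exact inv_nonneg.mpr (by linarith)
    · intro p hp
      exact inv_one_sub_le_exp (hhalf p hp)
  have h2 := Real.log_le_log hlog h1
  rw [Real.log_exp, Finset.sum_add_distrib, ← Finset.mul_sum] at h2
  have h3 : ∑ p ∈ primesUpTo n, ((p : ℝ)⁻¹) ^ 2 ≤ ∑' m : ℕ, ((m : ℝ) ^ 2)⁻¹ := by
    simp_rw [inv_pow]
    exact hsum.sum_le_tsum _ fun m _ => by positivity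
  linarith

/-- Since e^u ≤ (1 - u)⁻¹, the exponential of the left side is at most a finite Euler product, which
is a subsum of ζ(s). -/
theorem sum_rpow_neg_le_log_tsum {s : ℝ} (hs : 1 < s) (n : ℕ) :
    ∑ p ∈ primesUpTo n, (p : ℝ) ^ (-s) ≤ Real.log (∑' m : ℕ, (m : ℝ) ^ (-s)) := by
  have hs0 : 0 < s := by linarith
  have h := hasSum_factoredNumbers_primesUpTo hs0 n
  have hsum : Summable fun m : ℕ => (m : ℝ) ^ (-s) := Real.summable_nat_rpow.mpr (by linarith)
  have h1 : ∏ p ∈ primesUpTo n, (1 - (p : ℝ) ^ (-s))⁻¹ ≤ ∑' m : ℕ, (m : ℝ) ^ (-s) := by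
    rw [← h.tsum_eq]
    exact hsum.tsum_subtype_le _ _ (fun m => Real.rpow_nonneg (Nat.cast_nonneg m) _)
  have h2 : Real.exp (∑ p ∈ primesUpTo n, (p : ℝ) ^ (-s)) ≤
      ∏ p ∈ primesUpTo n, (1 - (p : ℝ) ^ (-s))⁻¹ := by
    rw [Real.exp_sum]
    refine Finset.prod_le_prod (fun p _ => (Real.exp_pos _).le) fun p hp => ?_
    have hlt : (p : ℝ) ^ (-s) < 1 := Real.rpow_lt_one_of_one_lt_of_neg
      (by exact_mod_cast (prime_of_mem_primesUpTo hp).one_lt) (by linarith)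
    rw [le_inv_comm₀ (Real.exp_pos _) (by linarith), ← Real.exp_neg]
    linarith [Real.add_one_le_exp (-(p : ℝ) ^ (-s))]
  rw [Real.le_log_iff_exp_le ((Real.exp_pos _).trans_le (h2.trans h1))]
  exact h2.trans h1

theorem tendsto_log_nat_atTop : Tendsto (fun n : ℕ => Real.log n) atTop atTop :=
  Real.tendsto_log_atTop.comp tendsto_natCast_atTop_atTop

theorem tendsto_log_log_nat_atTop :
    Tendsto (fun n : ℕ => Real.log (Real.log n)) atTop atTop :=
  Real.tendsto_log_atTop.comp tendsto_log_nat_atTop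

/-- Compare with ζ(1 + κ) for κ = 1/(L log n), where L = log log n. For p ≤ n, replacing p⁻¹ by
p^{-(1+κ)} costs a factor e^{1/L} → 1; the simpler κ = 1/log n would cost a factor e. Since κ ζ(1 +
κ) → 1, eventually ζ(1 + κ) < 2 L log n, whose logarithm is L + O(log L). -/
theorem eventually_sum_inv_le :
    ∀ᶠ n : ℕ in atTop, ∑ p ∈ primesUpTo n, (p : ℝ)⁻¹ ≤
      Real.exp (1 / Real.log (Real.log n)) *
        (Real.log 2 + Real.log (Real.log n) + Real.log (Real.log (Real.log n))) := by
  have hs : Tendsto (fun n : ℕ => 1 + 1 / (Real.log (Real.log n) * Real.log n)) atTop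
      (𝓝[>] 1) := by
    have h1 : Tendsto (fun n : ℕ => 1 / (Real.log (Real.log n) * Real.log n)) atTop (𝓝[>] 0) := by
      simp_rw [one_div]
      exact tendsto_inv_atTop_nhdsGT_zero.comp
        (tendsto_log_log_nat_atTop.atTop_mul_atTop₀ tendsto_log_nat_atTop)
    rw [tendsto_nhdsWithin_iff] at h1 ⊢
    refine ⟨by simpa using h1.1.const_add 1, ?_⟩
    filter_upwards [h1.2] with n hn
    simpa using hn
  have hz := (tendsto_sub_mul_tsum_nat_rpow.comp hs).eventually_lt_const (show (1 : ℝ) < 2 by norm_num)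
  filter_upwards [hz, tendsto_log_log_nat_atTop.eventually_gt_atTop 0,
    tendsto_log_nat_atTop.eventually_gt_atTop 0, eventually_ge_atTop 1] with n hn hL hl hn1
  set L := Real.log (Real.log n)
  set l := Real.log n
  set κ := 1 / (L * l) with hκ
  have hκ0 : 0 < κ := by positivity
  simp only [Function.comp_apply, add_sub_cancel_left] at hn
  have hn' : ∑' m : ℕ, (m : ℝ) ^ (-(1 + κ)) < 2 * (L * l) := by
    have e : ∀ m : ℕ, 1 / (m : ℝ) ^ (1 + κ) = (m : ℝ) ^ (-(1 + κ)) := fun m => by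
      rw [Real.rpow_neg (Nat.cast_nonneg m), one_div]
    change κ * ∑' m : ℕ, 1 / (m : ℝ) ^ (1 + κ) < 2 at hn
    simp_rw [e] at hn
    rw [hκ, div_mul_eq_mul_div, one_mul, div_lt_iff₀ (by positivity)] at hn
    exact hn
  have hpos : 0 < ∑' m : ℕ, (m : ℝ) ^ (-(1 + κ)) := by
    have hsum : Summable fun m : ℕ => (m : ℝ) ^ (-(1 + κ)) :=
      Real.summable_nat_rpow.mpr (by linarith)
    exact hsum.tsum_pos (fun m => by positivity) 1 (by simp)
  have hlog : Real.log (∑' m : ℕ, (m : ℝ) ^ (-(1 + κ))) ≤ Real.log 2 + L + Real.log L := by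
    refine (Real.log_le_log hpos hn'.le).trans_eq ?_
    rw [Real.log_mul two_ne_zero (by positivity), Real.log_mul hL.ne' hl.ne']
    ring
  have hterm : ∀ p ∈ primesUpTo n, (p : ℝ)⁻¹ ≤ Real.exp (1 / L) * (p : ℝ) ^ (-(1 + κ)) := by
    intro p hp
    have hp0 : (0 : ℝ) < p := by exact_mod_cast (prime_of_mem_primesUpTo hp).pos
    have hpn : (p : ℝ) ≤ n := by exact_mod_cast le_of_mem_primesUpTo hp
    have e : (p : ℝ) ^ (-(1 + κ)) = (p : ℝ)⁻¹ * (p : ℝ) ^ (-κ) := by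
      rw [neg_add, Real.rpow_add hp0, Real.rpow_neg_one]
    have h1 : (1 : ℝ) ≤ Real.exp (1 / L) * (p : ℝ) ^ (-κ) := by
      rw [Real.rpow_def_of_pos hp0, ← Real.exp_add]
      refine Real.one_le_exp ?_
      have h2 : Real.log p ≤ l := Real.log_le_log hp0 hpn
      have h3 : l * κ = 1 / L := by rw [hκ]; field_simp
      nlinarith
    rw [e]
    calc (p : ℝ)⁻¹ = (p : ℝ)⁻¹ * 1 := (mul_one _).symm
      _ ≤ (p : ℝ)⁻¹ * (Real.exp (1 / L) * (p : ℝ) ^ (-κ)) :=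
        mul_le_mul_of_nonneg_left h1 (by positivity)
      _ = _ := by ring
  calc _ ≤ ∑ p ∈ primesUpTo n, Real.exp (1 / L) * (p : ℝ) ^ (-(1 + κ)) := Finset.sum_le_sum hterm
    _ = Real.exp (1 / L) * ∑ p ∈ primesUpTo n, (p : ℝ) ^ (-(1 + κ)) := by rw [Finset.mul_sum]
    _ ≤ _ := mul_le_mul_of_nonneg_left
        ((sum_rpow_neg_le_log_tsum (by linarith) n).trans hlog) (Real.exp_pos _).le

theorem tendsto_log_div_self_atTop : Tendsto (fun x : ℝ => Real.log x / x) atTop (𝓝 0) := by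
  simpa using Real.isLittleO_log_id_atTop.tendsto_div_nhds_zero

/-- A weak form of **Mertens' second theorem**. -/
theorem tendsto_sum_inv_div_log_log :
    Tendsto (fun n : ℕ => (∑ p ∈ primesUpTo n, (p : ℝ)⁻¹) / Real.log (Real.log n)) atTop
      (𝓝 1) := by
  obtain ⟨C, hC⟩ := exists_log_log_sub_le_sum_inv
  have hlow : Tendsto (fun n : ℕ => 1 - C / Real.log (Real.log n)) atTop (𝓝 1) := by
    simpa using (tendsto_log_log_nat_atTop.const_div_atTop C).const_sub 1
  have hup : Tendsto (fun n : ℕ => Real.exp (1 / Real.log (Real.log n)) *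
      (Real.log 2 / Real.log (Real.log n) + 1 +
        Real.log (Real.log (Real.log n)) / Real.log (Real.log n))) atTop (𝓝 1) := by
    have h1 := (Real.continuous_exp.tendsto 0).comp
      (tendsto_log_log_nat_atTop.const_div_atTop (1 : ℝ))
    have h2 := ((tendsto_log_log_nat_atTop.const_div_atTop (Real.log 2)).add_const 1).add
      (tendsto_log_div_self_atTop.comp tendsto_log_log_nat_atTop)
    simpa using h1.mul h2
  refine tendsto_of_tendsto_of_tendsto_of_le_of_le' hlow hup ?_ ?_
  · filter_upwards [tendsto_log_log_nat_atTop.eventually_gt_atTop 0, eventually_ge_atTop 2]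
      with n hL hn
    rw [le_div_iff₀ hL, sub_mul, div_mul_cancel₀ _ hL.ne', one_mul]
    exact hC n hn
  · filter_upwards [tendsto_log_log_nat_atTop.eventually_gt_atTop 0, eventually_sum_inv_le]
      with n hL hn
    rw [div_le_iff₀ hL]
    refine hn.trans_eq ?_
    field_simp

/-! ### Means of products over prime divisors -/

/-- The mean over `v ∈ {1, …, n}` of the product of `f p` over the `p ∈ s` dividing `v`. -/
def dvdProductMean (n : ℕ) (s : Finset ℕ) (f : ℕ → ℝ) : ℝ :=
  (∑ v ∈ Finset.Icc 1 n, ∏ p ∈ s, if p ∣ v then f p else 1) / n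

theorem dvdProductMean_mono {n : ℕ} {s : Finset ℕ} {f f' : ℕ → ℝ} (hf : ∀ p ∈ s, 0 ≤ f p)
    (h : ∀ p ∈ s, f p ≤ f' p) : dvdProductMean n s f ≤ dvdProductMean n s f' := by
  refine div_le_div_of_nonneg_right (Finset.sum_le_sum fun v _ => Finset.prod_le_prod ?_ ?_)
    (Nat.cast_nonneg n)
  · intro p hp
    split_ifs
    exacts [hf p hp, zero_le_one]
  · intro p hp
    split_ifs
    exacts [h p hp, le_rfl]

theorem forall_dvd_iff_prod_dvd {t : Finset ℕ} (ht : ∀ p ∈ t, p.Prime) (v : ℕ) :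
    (∀ p ∈ t, p ∣ v) ↔ ∏ p ∈ t, p ∣ v :=
  ⟨fun h => Finset.prod_primes_dvd v (fun p hp => (ht p hp).prime) h,
    fun h _ hp => (Finset.dvd_prod_of_mem _ hp).trans h⟩

theorem card_Icc_filter_dvd (n d : ℕ) : ((Finset.Icc 1 n).filter (d ∣ ·)).card = n / d :=
  Nat.Ioc_filter_dvd_card_eq_div n d

/-- Expanding the product over subsets of `s` reduces the mean to counting multiples of squarefree
numbers. -/
theorem dvdProductMean_one_add {n : ℕ} {s : Finset ℕ} (hs : ∀ p ∈ s, p.Prime) (h : ℕ → ℝ) :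
    dvdProductMean n s (fun p => 1 + h p) =
      ∑ t ∈ s.powerset, (∏ p ∈ t, h p) * (((n / ∏ p ∈ t, p : ℕ) : ℝ) / n) := by
  have h1 : ∀ v : ℕ, ∏ p ∈ s, (if p ∣ v then 1 + h p else 1) =
      ∑ t ∈ s.powerset, if ∏ p ∈ t, p ∣ v then ∏ p ∈ t, h p else 0 := by
    intro v
    have : ∀ p, (if p ∣ v then 1 + h p else 1) = (if p ∣ v then h p else 0) + 1 := by
      intro p
      split_ifs <;> ring
    simp_rw [this, Finset.prod_add_one]
    refine Finset.sum_congr rfl fun t ht => ?_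
    have ht' : ∀ p ∈ t, p.Prime := fun p hp => hs p (Finset.mem_powerset.mp ht hp)
    rw [Finset.prod_ite_zero]
    simp only [forall_dvd_iff_prod_dvd ht']
  unfold dvdProductMean
  simp_rw [h1]
  rw [Finset.sum_comm, Finset.sum_div]
  refine Finset.sum_congr rfl fun t _ => ?_
  rw [← Finset.sum_filter, Finset.sum_const, card_Icc_filter_dvd, nsmul_eq_mul]
  ring

/-- An upper bound without any restriction on the size of the primes. Replacing f by 1 + f makes all
coefficients nonnegative, so ⌊n/d⌋/n ≤ 1/d applies termwise. The extra ∑ 1/p in the exponent is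
harmless for the large primes. -/
theorem dvdProductMean_le_exp {n : ℕ} {s : Finset ℕ} (hs : ∀ p ∈ s, p.Prime) {f : ℕ → ℝ}
    (hf : ∀ p ∈ s, 0 ≤ f p) : dvdProductMean n s f ≤ Real.exp (∑ p ∈ s, f p / p) := by
  calc dvdProductMean n s f ≤ dvdProductMean n s (fun p => 1 + f p) :=
        dvdProductMean_mono hf fun p _ => by linarith
    _ = ∑ t ∈ s.powerset, (∏ p ∈ t, f p) * (((n / ∏ p ∈ t, p : ℕ) : ℝ) / n) :=
        dvdProductMean_one_add hs f
    _ ≤ ∑ t ∈ s.powerset, ∏ p ∈ t, (f p / p) := by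
        refine Finset.sum_le_sum fun t ht => ?_
        rw [Finset.prod_div_distrib, div_eq_mul_inv (∏ p ∈ t, f p)]
        refine mul_le_mul_of_nonneg_left ?_
          (Finset.prod_nonneg fun p hp => hf p (Finset.mem_powerset.mp ht hp))
        rcases Nat.eq_zero_or_pos n with rfl | hn
        · simp only [Nat.cast_zero, div_zero]
          exact inv_nonneg.mpr (Finset.prod_nonneg fun p _ => Nat.cast_nonneg p)
        rw [div_le_iff₀ (by exact_mod_cast hn), inv_mul_eq_div]
        refine Nat.cast_div_le.trans_eq ?_
        push_cast
        rfl
    _ = ∏ p ∈ s, (f p / p + 1) := (Finset.prod_add_one s).symm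
    _ ≤ ∏ p ∈ s, Real.exp (f p / p) :=
        Finset.prod_le_prod (fun p hp => by have := hf p hp; positivity)
          fun p _ => Real.add_one_le_exp _
    _ = Real.exp (∑ p ∈ s, f p / p) := (Real.exp_sum s _).symm

/-- **Rankin's trick** for the error in counting multiples. -/
theorem abs_div_div_sub_inv_le {n d : ℕ} (hn : 0 < n) (hd : 0 < d) {κ : ℝ} (hκ0 : 0 ≤ κ)
    (hκ1 : κ ≤ 1) :
    |((n / d : ℕ) : ℝ) / n - (d : ℝ)⁻¹| ≤ (n : ℝ) ^ (-κ) * ((d : ℝ) ^ κ / d) := by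
  have hn' : (0 : ℝ) < n := by exact_mod_cast hn
  have hd' : (0 : ℝ) < d := by exact_mod_cast hd
  have hle : ((n / d : ℕ) : ℝ) ≤ n / d := Nat.cast_div_le
  have hge : (n : ℝ) / d - 1 ≤ ((n / d : ℕ) : ℝ) := by
    rw [← Nat.floor_div_eq_div (K := ℝ)]
    exact (Nat.sub_one_lt_floor _).le
  have habs : |((n / d : ℕ) : ℝ) / n - (d : ℝ)⁻¹| = (d : ℝ)⁻¹ - ((n / d : ℕ) : ℝ) / n := by
    rw [abs_sub_comm, abs_of_nonneg]
    rw [sub_nonneg, div_le_iff₀ hn', inv_mul_eq_div]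
    exact hle
  have h1 : (d : ℝ)⁻¹ - ((n / d : ℕ) : ℝ) / n ≤ (d : ℝ)⁻¹ := by
    have : (0 : ℝ) ≤ ((n / d : ℕ) : ℝ) / n := by positivity
    linarith
  have h2 : (d : ℝ)⁻¹ - ((n / d : ℕ) : ℝ) / n ≤ (n : ℝ)⁻¹ := by
    have := div_le_div_of_nonneg_right hge hn'.le
    have e : ((n : ℝ) / d - 1) / n = (d : ℝ)⁻¹ - (n : ℝ)⁻¹ := by field_simp
    rw [e] at this
    linarith
  rw [habs, Real.rpow_neg hn'.le, ← mul_div_assoc, inv_mul_eq_div,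
    ← Real.div_rpow hd'.le hn'.le]
  -- If d ≥ n, use the error bound 1/d and (d/n)^κ ≥ 1; if d ≤ n, use 1/n = (d/n)/d and κ ≤ 1.
  rcases le_total n d with h | h
  · refine h1.trans ?_
    rw [inv_eq_one_div]
    refine div_le_div_of_nonneg_right (Real.one_le_rpow ?_ hκ0) hd'.le
    rw [one_le_div hn']
    exact_mod_cast h
  · refine h2.trans ?_
    have h3 : (d : ℝ) / n ≤ ((d : ℝ) / n) ^ κ := by
      have := Real.rpow_le_rpow_of_exponent_ge (x := (d : ℝ) / n) (by positivity)
        ((div_le_one hn').mpr (by exact_mod_cast h)) hκ1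
      simpa using this
    calc (n : ℝ)⁻¹ = (d : ℝ) / n / d := by field_simp
      _ ≤ _ := div_le_div_of_nonneg_right h3 hd'.le

theorem abs_dvdProductMean_sub_prod_le {n : ℕ} (hn : 0 < n) {s : Finset ℕ}
    (hs : ∀ p ∈ s, p.Prime) (f : ℕ → ℝ) {κ : ℝ} (hκ0 : 0 ≤ κ) (hκ1 : κ ≤ 1) :
    |dvdProductMean n s f - ∏ p ∈ s, (1 + (f p - 1) / p)| ≤
      (n : ℝ) ^ (-κ) * Real.exp (∑ p ∈ s, |f p - 1| * (p : ℝ) ^ κ / p) := by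
  have e1 : dvdProductMean n s f = ∑ t ∈ s.powerset,
      (∏ p ∈ t, (f p - 1)) * (((n / ∏ p ∈ t, p : ℕ) : ℝ) / n) := by
    rw [← dvdProductMean_one_add hs]
    simp
  have e2 : ∏ p ∈ s, (1 + (f p - 1) / p) = ∑ t ∈ s.powerset,
      (∏ p ∈ t, (f p - 1)) * ((∏ p ∈ t, p : ℕ) : ℝ)⁻¹ := by
    simp_rw [add_comm (1 : ℝ), Finset.prod_add_one, Finset.prod_div_distrib, div_eq_mul_inv]
    push_cast
    rfl
  rw [e1, e2, ← Finset.sum_sub_distrib]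
  calc _ ≤ ∑ t ∈ s.powerset, |(∏ p ∈ t, (f p - 1)) * (((n / ∏ p ∈ t, p : ℕ) : ℝ) / n) -
          (∏ p ∈ t, (f p - 1)) * ((∏ p ∈ t, p : ℕ) : ℝ)⁻¹| := Finset.abs_sum_le_sum_abs _ _
    _ ≤ ∑ t ∈ s.powerset, (n : ℝ) ^ (-κ) * ∏ p ∈ t, (|f p - 1| * (p : ℝ) ^ κ / p) := by
        refine Finset.sum_le_sum fun t ht => ?_
        have ht' : ∀ p ∈ t, p.Prime := fun p hp => hs p (Finset.mem_powerset.mp ht hp)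
        rw [← mul_sub, abs_mul, Finset.abs_prod, Finset.prod_div_distrib, Finset.prod_mul_distrib,
          Real.finsetProd_rpow _ _ (fun p _ => Nat.cast_nonneg p)]
        have := abs_div_div_sub_inv_le hn (Finset.prod_pos fun p hp => (ht' p hp).pos) hκ0 hκ1
        calc _ ≤ (∏ p ∈ t, |f p - 1|) * _ :=
              mul_le_mul_of_nonneg_left this (Finset.prod_nonneg fun p _ => abs_nonneg _)
          _ = _ := by push_cast; ring
    _ = (n : ℝ) ^ (-κ) * ∏ p ∈ s, (|f p - 1| * (p : ℝ) ^ κ / p + 1) := by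
        rw [← Finset.mul_sum, Finset.prod_add_one]
    _ ≤ (n : ℝ) ^ (-κ) * ∏ p ∈ s, Real.exp (|f p - 1| * (p : ℝ) ^ κ / p) := by
        refine mul_le_mul_of_nonneg_left ?_ (by positivity)
        exact Finset.prod_le_prod (fun p _ => by positivity) fun p _ => Real.add_one_le_exp _
    _ = _ := by rw [← Real.exp_sum]

/-! ### The cut between small and large primes -/

/-- The threshold `exp (log n / (log log n) ^ 2)` below which a prime counts as small. -/
def smallPrimeBound (n : ℕ) : ℕ := ⌊Real.exp (Real.log n / Real.log (Real.log n) ^ 2)⌋₊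

theorem tendsto_log_div_sq_log_log :
    Tendsto (fun n : ℕ => Real.log n / Real.log (Real.log n) ^ 2) atTop atTop := by
  have h1 : Tendsto (fun x : ℝ => Real.log x ^ 2 / x) atTop (𝓝 0) :=
    Real.isLittleO_pow_log_id_atTop.tendsto_div_nhds_zero
  have h2 : Tendsto (fun x : ℝ => Real.log x ^ 2 / x) atTop (𝓝[>] 0) := by
    rw [tendsto_nhdsWithin_iff]
    refine ⟨h1, ?_⟩
    filter_upwards [Real.tendsto_log_atTop.eventually_gt_atTop 0, eventually_gt_atTop 0] with x h h'
    exact div_pos (pow_pos h 2) h'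
  have h3 := (tendsto_inv_nhdsGT_zero.comp h2).comp tendsto_log_nat_atTop
  refine h3.congr fun n => ?_
  simp [inv_div]

theorem tendsto_smallPrimeBound : Tendsto smallPrimeBound atTop atTop :=
  tendsto_nat_floor_atTop.comp (Real.tendsto_exp_atTop.comp tendsto_log_div_sq_log_log)

theorem log_smallPrimeBound_le {n : ℕ} (hn : 0 < smallPrimeBound n) :
    Real.log (smallPrimeBound n) ≤ Real.log n / Real.log (Real.log n) ^ 2 := by
  rw [← Real.log_exp (Real.log n / Real.log (Real.log n) ^ 2)]
  exact Real.log_le_log (by exact_mod_cast hn) (Nat.floor_le (Real.exp_pos _).le)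

theorem eventually_smallPrimeBound_le : ∀ᶠ n in atTop, smallPrimeBound n ≤ n := by
  filter_upwards [tendsto_log_log_nat_atTop.eventually_ge_atTop 1,
    tendsto_log_nat_atTop.eventually_ge_atTop 0, eventually_gt_atTop 0] with n hL hl hn
  refine Nat.floor_le_of_le ?_
  calc Real.exp (Real.log n / Real.log (Real.log n) ^ 2) ≤ Real.exp (Real.log n) :=
        Real.exp_le_exp.mpr (div_le_self hl (one_le_pow₀ hL))
    _ = n := Real.exp_log (by exact_mod_cast hn)

/-- The bound y satisfies log log y = L - 2 log L + O(1). Thus sums over primes that grow like a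
multiple of L keep their asymptotics when cut at y. -/
theorem tendsto_log_log_smallPrimeBound_div :
    Tendsto (fun n => Real.log (Real.log (smallPrimeBound n)) / Real.log (Real.log n)) atTop
      (𝓝 1) := by
  have hlow : Tendsto (fun n : ℕ => 1 - 2 * (Real.log (Real.log (Real.log n)) /
      Real.log (Real.log n)) - Real.log 2 / Real.log (Real.log n)) atTop (𝓝 1) := by
    have h1 := (tendsto_log_div_self_atTop.comp tendsto_log_log_nat_atTop).const_mul 2
    have h2 := tendsto_log_log_nat_atTop.const_div_atTop (Real.log 2)
    simpa using (h1.const_sub 1).sub h2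
  refine tendsto_of_tendsto_of_tendsto_of_le_of_le' hlow tendsto_const_nhds ?_ ?_
  · filter_upwards [tendsto_log_log_nat_atTop.eventually_gt_atTop 0,
      tendsto_log_nat_atTop.eventually_gt_atTop 0,
      tendsto_log_div_sq_log_log.eventually_ge_atTop 2] with n hL hl hw
    set L := Real.log (Real.log n) with hLdef
    set w := Real.log n / L ^ 2 with hw'
    have h1 : Real.exp (w / 2) ≤ smallPrimeBound n := by
      have h2 : Real.exp w - 1 ≤ smallPrimeBound n := (Nat.sub_one_lt_floor _).le
      have h3 : Real.exp w = Real.exp (w / 2) * Real.exp (w / 2) := by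
        rw [← Real.exp_add]; ring_nf
      have h4 : 2 ≤ Real.exp (w / 2) := by linarith [Real.add_one_le_exp (w / 2)]
      nlinarith
    have h5 : w / 2 ≤ Real.log (smallPrimeBound n) := by
      rw [← Real.log_exp (w / 2)]
      exact Real.log_le_log (Real.exp_pos _) h1
    have h6 := Real.log_le_log (by linarith) h5
    rw [Real.log_div (by linarith) two_ne_zero, hw', Real.log_div hl.ne' (by positivity),
      Real.log_pow, ← hLdef] at h6
    rw [le_div_iff₀ hL]
    calc _ = L - 2 * Real.log L - Real.log 2 := by field_simp
      _ ≤ _ := by push_cast at h6; linarith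
  · filter_upwards [tendsto_log_log_nat_atTop.eventually_gt_atTop 0,
      (tendsto_log_nat_atTop.comp tendsto_smallPrimeBound).eventually_gt_atTop 0,
      tendsto_smallPrimeBound.eventually_gt_atTop 0, eventually_smallPrimeBound_le]
      with n hL hl hy hle
    rw [div_le_one hL]
    exact Real.log_le_log hl (Real.log_le_log (by exact_mod_cast hy) (by exact_mod_cast hle))

theorem Filter.Tendsto.comp_smallPrimeBound {u : ℕ → ℝ} {c : ℝ}
    (h : Tendsto (fun n => u n / Real.log (Real.log n)) atTop (𝓝 c)) :
    Tendsto (fun n => u (smallPrimeBound n) / Real.log (Real.log n)) atTop (𝓝 c) := by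
  have h1 := (h.comp tendsto_smallPrimeBound).mul tendsto_log_log_smallPrimeBound_div
  rw [mul_one] at h1
  refine h1.congr' ?_
  filter_upwards [(tendsto_log_log_nat_atTop.comp tendsto_smallPrimeBound).eventually_ne_atTop 0]
    with n hn
  exact div_mul_div_cancel₀ hn

/-- The primes up to K contribute a constant, and beyond K the extra factor 1/p gains at least 1/K.
-/
theorem tendsto_sum_div_sq_div_log_log {a : ℕ → ℝ} (ha : ∀ p, 0 ≤ a p) {M : ℝ}
    (h : Tendsto (fun n => (∑ p ∈ primesUpTo n, a p / p) / Real.log (Real.log n)) atTop (𝓝 M)) :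
    Tendsto (fun n => (∑ p ∈ primesUpTo n, a p / (p : ℝ) ^ 2) / Real.log (Real.log n)) atTop
      (𝓝 0) := by
  rw [Metric.tendsto_nhds]
  intro ε hε
  obtain ⟨K, hK, hK0⟩ : ∃ K : ℕ, (|M| + 1) / (K : ℝ) < ε / 2 ∧ 0 < K :=
    (((tendsto_natCast_atTop_atTop (R := ℝ)).const_div_atTop (|M| + 1)).eventually_lt_const
      (half_pos hε) |>.and (eventually_gt_atTop 0)).exists
  have hK0' : (0 : ℝ) < K := by exact_mod_cast hK0
  set c := ∑ p ∈ primesUpTo K, a p / (p : ℝ) ^ 2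
  filter_upwards [tendsto_log_log_nat_atTop.eventually_gt_atTop 0,
    (tendsto_log_log_nat_atTop.const_div_atTop c).eventually_lt_const (half_pos hε),
    h.eventually_le_const (show M < |M| + 1 by linarith [le_abs_self M])] with n hL hc hM
  rw [Real.dist_eq, sub_zero, abs_of_nonneg
    (div_nonneg (Finset.sum_nonneg fun p _ => div_nonneg (ha p) (by positivity)) hL.le)]
  have hsplit : ∑ p ∈ primesUpTo n, a p / (p : ℝ) ^ 2 ≤
      c + (∑ p ∈ primesUpTo n, a p / p) / K := by
    rw [← Finset.sum_filter_add_sum_filter_not (primesUpTo n) (fun p => p ≤ K)]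
    refine add_le_add ?_ ?_
    · refine Finset.sum_le_sum_of_subset_of_nonneg ?_
        fun p _ _ => div_nonneg (ha p) (by positivity)
      intro p hp
      rw [Finset.mem_filter] at hp
      exact mem_primesUpTo.mpr ⟨hp.2, prime_of_mem_primesUpTo hp.1⟩
    · rw [Finset.sum_div]
      refine (Finset.sum_le_sum fun p hp => ?_).trans
        (Finset.sum_le_sum_of_subset_of_nonneg (Finset.filter_subset _ _)
          fun p _ _ => div_nonneg (div_nonneg (ha p) (Nat.cast_nonneg p)) hK0'.le)
      rw [Finset.mem_filter, not_le] at hp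
      have hp0 : (0 : ℝ) < p := by exact_mod_cast hK0.trans hp.2
      rw [div_div, sq]
      refine div_le_div_of_nonneg_left (ha p) (mul_pos hp0 hK0') ?_
      exact mul_le_mul_of_nonneg_left (by exact_mod_cast hp.2.le) hp0.le
  calc _ ≤ (c + (∑ p ∈ primesUpTo n, a p / p) / K) / Real.log (Real.log n) :=
        div_le_div_of_nonneg_right hsplit hL.le
    _ = c / Real.log (Real.log n) +
        (∑ p ∈ primesUpTo n, a p / p) / Real.log (Real.log n) / K := by
        rw [add_div, div_right_comm]
    _ ≤ c / Real.log (Real.log n) + (|M| + 1) / K := by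
        have := div_le_div_of_nonneg_right hM hK0'.le
        linarith
    _ < ε := by linarith

theorem sub_two_mul_sq_le_log_one_add {u : ℝ} (hu : -(1 / 2) ≤ u) :
    u - 2 * u ^ 2 ≤ Real.log (1 + u) := by
  have h1 : 0 < 1 + u := by linarith
  refine le_trans ?_ (Real.one_sub_inv_le_log_of_pos h1)
  have h2 : 1 - (1 + u)⁻¹ = u / (1 + u) := by field_simp; ring
  rw [h2, le_div_iff₀ h1]
  nlinarith [mul_nonneg (sq_nonneg u) (show 0 ≤ 1 + 2 * u by linarith)]

theorem neg_half_le_sub_one_div {f : ℝ} (hf : 0 < f) {p : ℕ} (hp : p.Prime) :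
    -(1 / 2) ≤ (f - 1) / p := by
  have h2 : (2 : ℝ) ≤ p := by exact_mod_cast hp.two_le
  rw [le_div_iff₀ (by linarith)]
  nlinarith

/-! ### Small and large primes for a positive multiplicative weight -/

section Multiplicative

variable {f : ℕ → ℝ} {M M₂ : ℝ}

theorem prod_one_add_pos (hf : ∀ p, 0 < f p) (m : ℕ) :
    0 < ∏ p ∈ primesUpTo m, (1 + (f p - 1) / p) :=
  Finset.prod_pos fun p hp => by
    linarith [neg_half_le_sub_one_div (hf p) (prime_of_mem_primesUpTo hp)]

/-- Apply u - 2u² ≤ log(1 + u) ≤ u to each factor. The second-order terms are O((f(p)² + 1)/p²), and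
the second-moment hypothesis makes their sum o(log log n). -/
theorem tendsto_log_prod_div_log_log (hf : ∀ p, 0 < f p)
    (h1 : Tendsto (fun n => (∑ p ∈ primesUpTo n, f p / p) / Real.log (Real.log n)) atTop (𝓝 M))
    (h2 : Tendsto (fun n => (∑ p ∈ primesUpTo n, f p ^ 2 / p) / Real.log (Real.log n)) atTop
      (𝓝 M₂)) :
    Tendsto (fun n => Real.log (∏ p ∈ primesUpTo n, (1 + (f p - 1) / p)) / Real.log (Real.log n))
      atTop (𝓝 (M - 1)) := by
  have hup := h1.sub tendsto_sum_inv_div_log_log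
  have hsq := tendsto_sum_div_sq_div_log_log (a := fun p => f p ^ 2 + 1)
    (fun p => by positivity) (M := M₂ + 1) (by
      refine (h2.add tendsto_sum_inv_div_log_log).congr fun n => ?_
      rw [← add_div, ← Finset.sum_add_distrib]
      simp only [add_div, one_div])
  have hlow := hup.sub (hsq.const_mul 2)
  rw [mul_zero, sub_zero] at hlow
  have hlog : ∀ n, Real.log (∏ p ∈ primesUpTo n, (1 + (f p - 1) / p)) =
      ∑ p ∈ primesUpTo n, Real.log (1 + (f p - 1) / p) := fun n =>
    Real.log_prod fun p hp => by
      linarith [neg_half_le_sub_one_div (hf p) (prime_of_mem_primesUpTo hp)]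
  refine tendsto_of_tendsto_of_tendsto_of_le_of_le' hlow hup ?_ ?_
  · filter_upwards [tendsto_log_log_nat_atTop.eventually_gt_atTop 0] with n hL
    rw [← sub_div, ← mul_div_assoc, ← sub_div, hlog]
    refine div_le_div_of_nonneg_right ?_ hL.le
    rw [← Finset.sum_sub_distrib, Finset.mul_sum, ← Finset.sum_sub_distrib]
    refine Finset.sum_le_sum fun p hp => ?_
    refine le_trans ?_ (sub_two_mul_sq_le_log_one_add
      (neg_half_le_sub_one_div (hf p) (prime_of_mem_primesUpTo hp)))
    have h3 : ((f p - 1) / p) ^ 2 ≤ (f p ^ 2 + 1) / (p : ℝ) ^ 2 := by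
      rw [div_pow]
      exact div_le_div_of_nonneg_right (by nlinarith [hf p]) (by positivity)
    rw [← one_div, ← sub_div]
    linarith
  · filter_upwards [tendsto_log_log_nat_atTop.eventually_gt_atTop 0] with n hL
    rw [← sub_div, hlog]
    refine div_le_div_of_nonneg_right ?_ hL.le
    rw [← Finset.sum_sub_distrib]
    refine Finset.sum_le_sum fun p hp => ?_
    have := Real.log_le_sub_one_of_pos (show 0 < 1 + (f p - 1) / p by
      linarith [neg_half_le_sub_one_div (hf p) (prime_of_mem_primesUpTo hp)])
    rw [← one_div, ← sub_div]
    linarith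

/-- Rankin's exponent κ = L²/log n is matched to the threshold: n^{-κ} = exp(-L²), while p^κ ≤ e for
every small prime. -/
theorem eventually_abs_dvdProductMean_sub_prod_le (hf : ∀ p, 0 < f p)
    (h1 : Tendsto (fun n => (∑ p ∈ primesUpTo n, f p / p) / Real.log (Real.log n)) atTop (𝓝 M)) :
    ∀ᶠ n in atTop, |dvdProductMean n (primesUpTo (smallPrimeBound n)) f -
        ∏ p ∈ primesUpTo (smallPrimeBound n), (1 + (f p - 1) / p)| ≤
      Real.exp (-Real.log (Real.log n) ^ 2 +
        Real.exp 1 * (M + 2) * Real.log (Real.log n)) := by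
  have hsum := (h1.add tendsto_sum_inv_div_log_log).congr fun n => (add_div _ _ _).symm
  filter_upwards [eventually_gt_atTop 0, tendsto_log_log_nat_atTop.eventually_gt_atTop 0,
    tendsto_log_nat_atTop.eventually_gt_atTop 0,
    tendsto_log_div_sq_log_log.eventually_ge_atTop 1,
    tendsto_smallPrimeBound.eventually_gt_atTop 0,
    hsum.comp_smallPrimeBound.eventually_le_const (show M + 1 < M + 2 by linarith)]
    with n hn hL hl hw hy hS
  rw [div_le_iff₀ hL] at hS
  set L := Real.log (Real.log n)
  set κ := L ^ 2 / Real.log n with hκ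
  have hκ0 : 0 ≤ κ := by positivity
  have hκ1 : κ ≤ 1 := by
    rw [one_le_div (by positivity)] at hw
    exact (div_le_one hl).mpr hw
  refine (abs_dvdProductMean_sub_prod_le hn (fun p => prime_of_mem_primesUpTo) f hκ0 hκ1).trans ?_
  have e1 : (n : ℝ) ^ (-κ) = Real.exp (-L ^ 2) := by
    rw [Real.rpow_def_of_pos (by exact_mod_cast hn), hκ]
    congr 1
    field_simp
  rw [e1, ← Real.exp_add]
  refine Real.exp_le_exp.mpr (add_le_add le_rfl ?_)
  calc ∑ p ∈ primesUpTo (smallPrimeBound n), |f p - 1| * (p : ℝ) ^ κ / p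
      ≤ ∑ p ∈ primesUpTo (smallPrimeBound n), Real.exp 1 * (f p / p + (p : ℝ)⁻¹) := by
        refine Finset.sum_le_sum fun p hp => ?_
        have hp0 : (0 : ℝ) < p := by exact_mod_cast (prime_of_mem_primesUpTo hp).pos
        have hk : (p : ℝ) ^ κ ≤ Real.exp 1 := by
          rw [Real.rpow_def_of_pos hp0]
          refine Real.exp_le_exp.mpr ?_
          have h2 : Real.log p ≤ Real.log n / L ^ 2 :=
            (Real.log_le_log hp0 (by exact_mod_cast le_of_mem_primesUpTo hp)).trans
              (log_smallPrimeBound_le hy)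
          calc Real.log p * κ ≤ Real.log n / L ^ 2 * κ := mul_le_mul_of_nonneg_right h2 hκ0
            _ = 1 := by rw [hκ]; field_simp
        have ha : |f p - 1| ≤ f p + 1 := abs_le.mpr ⟨by linarith [hf p], by linarith [hf p]⟩
        have e2 : Real.exp 1 * (f p / p + (p : ℝ)⁻¹) = (f p + 1) * Real.exp 1 / p := by
          field_simp
        rw [e2]
        refine div_le_div_of_nonneg_right ?_ hp0.le
        exact mul_le_mul ha hk (by positivity) (by linarith [hf p])
    _ = Real.exp 1 * (∑ p ∈ primesUpTo (smallPrimeBound n), f p / p +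
          ∑ p ∈ primesUpTo (smallPrimeBound n), (p : ℝ)⁻¹) := by
        rw [← Finset.mul_sum, Finset.sum_add_distrib]
    _ ≤ Real.exp 1 * ((M + 2) * L) := mul_le_mul_of_nonneg_left hS (Real.exp_pos _).le
    _ = _ := by ring

theorem abs_log_sub_log_le_log_two {x y : ℝ} (hx : 0 < x) (h : |y - x| ≤ x / 2) :
    |Real.log y - Real.log x| ≤ Real.log 2 := by
  obtain ⟨h1, h2⟩ := abs_le.mp h
  have hy : 0 < y := by linarith
  rw [abs_le]
  constructor
  · have := Real.log_le_log (by positivity : 0 < x) (show x ≤ 2 * y by linarith)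
    rw [Real.log_mul two_ne_zero hy.ne'] at this
    linarith
  · have := Real.log_le_log hy (show y ≤ 2 * x by linarith)
    rw [Real.log_mul two_ne_zero hx.ne'] at this
    linarith

/-- The small primes behave as if divisibility by distinct primes were independent. -/
theorem tendsto_log_dvdProductMean_small (hf : ∀ p, 0 < f p)
    (h1 : Tendsto (fun n => (∑ p ∈ primesUpTo n, f p / p) / Real.log (Real.log n)) atTop (𝓝 M))
    (h2 : Tendsto (fun n => (∑ p ∈ primesUpTo n, f p ^ 2 / p) / Real.log (Real.log n)) atTop
      (𝓝 M₂)) :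
    Tendsto (fun n => Real.log (dvdProductMean n (primesUpTo (smallPrimeBound n)) f) /
      Real.log (Real.log n)) atTop (𝓝 (M - 1)) := by
  have hmain := (tendsto_log_prod_div_log_log hf h1 h2).comp_smallPrimeBound
  have hclose : ∀ᶠ n in atTop, |Real.log (dvdProductMean n (primesUpTo (smallPrimeBound n)) f) -
      Real.log (∏ p ∈ primesUpTo (smallPrimeBound n), (1 + (f p - 1) / p))| ≤ Real.log 2 := by
    filter_upwards [eventually_abs_dvdProductMean_sub_prod_le hf h1,
      -- This size of L gives -L² + e(M + 2)L ≤ (M - 3)L ≤ (M - 2)L - 1. The product is at least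
      -- exp((M - 2)L), so the error is at most half of it.
      tendsto_log_log_nat_atTop.eventually_ge_atTop (Real.exp 1 * (M + 2) + 3 - M),
      tendsto_log_log_nat_atTop.eventually_ge_atTop 1,
      hmain.eventually_const_le (show M - 2 < M - 1 by linarith)] with n herr hL hL1 hlow
    set L := Real.log (Real.log n)
    rw [le_div_iff₀ (by linarith)] at hlow
    have hpos := prod_one_add_pos hf (smallPrimeBound n)
    refine abs_log_sub_log_le_log_two hpos (herr.trans ?_)
    have h3 : Real.exp ((M - 2) * L) ≤
        ∏ p ∈ primesUpTo (smallPrimeBound n), (1 + (f p - 1) / p) := by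
      rw [← Real.exp_log hpos]
      exact Real.exp_le_exp.mpr hlow
    have h4 : -L ^ 2 + Real.exp 1 * (M + 2) * L ≤ (M - 2) * L - 1 := by nlinarith
    have h5 : 2 ≤ Real.exp 1 := by linarith [Real.add_one_le_exp (1 : ℝ)]
    calc _ ≤ Real.exp ((M - 2) * L - 1) := Real.exp_le_exp.mpr h4
      _ = Real.exp ((M - 2) * L) / Real.exp 1 := Real.exp_sub _ _
      _ ≤ Real.exp ((M - 2) * L) / 2 := by gcongr
      _ ≤ _ := by linarith
  have hzero : Tendsto (fun n => (Real.log (dvdProductMean n (primesUpTo (smallPrimeBound n)) f) -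
      Real.log (∏ p ∈ primesUpTo (smallPrimeBound n), (1 + (f p - 1) / p))) /
        Real.log (Real.log n)) atTop (𝓝 0) := by
    refine squeeze_zero_norm' ?_ (tendsto_log_log_nat_atTop.const_div_atTop (Real.log 2))
    filter_upwards [hclose, tendsto_log_log_nat_atTop.eventually_gt_atTop 0] with n hn hL
    rw [Real.norm_eq_abs, abs_div, abs_of_pos hL]
    exact div_le_div_of_nonneg_right hn hL.le
  have := hzero.add hmain
  rw [zero_add] at this
  refine this.congr fun n => ?_
  rw [← add_div, sub_add_cancel]

theorem dvdProductMean_pos {n : ℕ} (hn : 0 < n) (s : Finset ℕ) (hf : ∀ p, 0 < f p) :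
    0 < dvdProductMean n s f := by
  refine div_pos (Finset.sum_pos (fun v _ => Finset.prod_pos fun p _ => ?_) ?_)
    (by exact_mod_cast hn)
  · split_ifs
    exacts [hf p, one_pos]
  · exact Finset.nonempty_Icc.mpr hn

/-- When ∑ f(p)/p is asymptotic to a multiple of log log n, both terms on the right have the same
limit, so the large primes contribute at most o(1). -/
theorem eventually_log_dvdProductMean_large_le (hf : ∀ p, 0 < f p) :
    ∀ᶠ n in atTop, Real.log (dvdProductMean n
        (primesUpTo n \ primesUpTo (smallPrimeBound n)) f) / Real.log (Real.log n) ≤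
      (∑ p ∈ primesUpTo n, f p / p) / Real.log (Real.log n) -
        (∑ p ∈ primesUpTo (smallPrimeBound n), f p / p) / Real.log (Real.log n) := by
  filter_upwards [eventually_gt_atTop 0, tendsto_log_log_nat_atTop.eventually_gt_atTop 0,
    eventually_smallPrimeBound_le] with n hn hL hy
  rw [← sub_div]
  refine div_le_div_of_nonneg_right ?_ hL.le
  have hsub : primesUpTo (smallPrimeBound n) ⊆ primesUpTo n := fun p hp =>
    mem_primesUpTo.mpr ⟨(le_of_mem_primesUpTo hp).trans hy, prime_of_mem_primesUpTo hp⟩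
  rw [Real.log_le_iff_le_exp (dvdProductMean_pos hn _ hf), sub_eq_iff_eq_add.mpr
    (Finset.sum_sdiff hsub).symm]
  exact dvdProductMean_le_exp (fun p hp => prime_of_mem_primesUpTo (Finset.sdiff_subset hp))
    fun p _ => (hf p).le

end Multiplicative

/-! ### Exponential moments of strongly additive functions -/

/-- The logarithm of the mean of `exp (φ v)` over `v ∈ {1, …, n}`. -/
def logMeanExp (n : ℕ) (φ : ℕ → ℝ) : ℝ :=
  Real.log ((∑ v ∈ Finset.Icc 1 n, Real.exp (φ v)) / n)

theorem logMeanExp_congr {n : ℕ} {φ ψ : ℕ → ℝ} (h : ∀ v ∈ Finset.Icc 1 n, φ v = ψ v) :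
    logMeanExp n φ = logMeanExp n ψ := by
  unfold logMeanExp
  rw [Finset.sum_congr rfl fun v hv => by rw [h v hv]]

/-- Hölder's inequality; the normalisation by n splits because 1/p + 1/q = 1. -/
theorem logMeanExp_add_le {n : ℕ} (hn : 0 < n) (φ ψ : ℕ → ℝ) {p q : ℝ}
    (hpq : p.HolderConjugate q) :
    logMeanExp n (fun v => φ v + ψ v) ≤
      logMeanExp n (fun v => p * φ v) / p + logMeanExp n (fun v => q * ψ v) / q := by
  have hn' : (0 : ℝ) < n := by exact_mod_cast hn
  have hsum : ∀ χ : ℕ → ℝ, 0 < ∑ v ∈ Finset.Icc 1 n, Real.exp (χ v) := fun χ =>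
    Finset.sum_pos (fun v _ => Real.exp_pos _) (Finset.nonempty_Icc.mpr hn)
  have key : ∀ χ : ℕ → ℝ, logMeanExp n χ =
      Real.log (∑ v ∈ Finset.Icc 1 n, Real.exp (χ v)) - Real.log n := fun χ =>
    Real.log_div (hsum χ).ne' hn'.ne'
  have hH := Real.inner_le_Lp_mul_Lq_of_nonneg (Finset.Icc 1 n)
    (f := fun v => Real.exp (φ v)) (g := fun v => Real.exp (ψ v)) hpq
    (fun v _ => (Real.exp_pos _).le) (fun v _ => (Real.exp_pos _).le)
  simp only [← Real.exp_add, ← Real.exp_mul] at hH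
  simp only [mul_comm _ p, mul_comm _ q] at hH
  have hlog := Real.log_le_log (hsum _) hH
  rw [Real.log_mul (Real.rpow_pos_of_pos (hsum _) _).ne' (Real.rpow_pos_of_pos (hsum _) _).ne',
    Real.log_rpow (hsum _), Real.log_rpow (hsum _)] at hlog
  rw [key, key, key]
  have h1 : p⁻¹ + q⁻¹ = 1 := hpq.inv_add_inv_eq_one
  have e : Real.log n = p⁻¹ * Real.log n + q⁻¹ * Real.log n := by rw [← add_mul, h1, one_mul]
  simp only [one_div] at hlog
  rw [sub_div, sub_div, div_eq_inv_mul, div_eq_inv_mul, div_eq_inv_mul, div_eq_inv_mul]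
  linarith

/-- The part of a strongly additive function that comes from the primes in `s`. -/
def additivePart (g : ℕ → ℝ) (s : Finset ℕ) (v : ℕ) : ℝ :=
  ∑ p ∈ s, if p ∣ v then g p else 0

theorem log_dvdProductMean_exp (n : ℕ) (s : Finset ℕ) (g : ℕ → ℝ) (θ : ℝ) :
    Real.log (dvdProductMean n s fun p => Real.exp (θ * g p)) =
      logMeanExp n fun v => θ * additivePart g s v := by
  unfold dvdProductMean logMeanExp additivePart
  congr 2
  refine Finset.sum_congr rfl fun v _ => ?_
  simp only [Finset.mul_sum, Real.exp_sum]
  refine Finset.prod_congr rfl fun p _ => ?_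
  split_ifs <;> simp

theorem IsStronglyAdditive.map_one {g : ℕ → ℝ} (hg : IsStronglyAdditive g) : g 1 = 0 := by
  have := hg.map_mul_of_coprime 1 1 one_pos one_pos (Nat.coprime_one_left 1)
  rw [mul_one] at this
  linarith

theorem IsStronglyAdditive.eq_sum_primeFactors {g : ℕ → ℝ} (hg : IsStronglyAdditive g) {v : ℕ}
    (hv : v ≠ 0) : g v = ∑ p ∈ v.primeFactors, g p := by
  induction v using Nat.recOnPosPrimePosCoprime with
  | prime_pow p k hp hk =>
    rw [hg.map_prime_pow p k hp hk, Nat.primeFactors_prime_pow hk.ne' hp, Finset.sum_singleton]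
  | zero => exact absurd rfl hv
  | one => simp [hg.map_one]
  | coprime a b ha hb hab iha ihb =>
    have ha0 : a ≠ 0 := by omega
    have hb0 : b ≠ 0 := by omega
    rw [hg.map_mul_of_coprime a b (Nat.pos_of_ne_zero ha0) (Nat.pos_of_ne_zero hb0) hab,
      iha ha0, ihb hb0, hab.primeFactors_mul,
      Finset.sum_union hab.disjoint_primeFactors]

theorem IsStronglyAdditive.eq_additivePart {g : ℕ → ℝ} (hg : IsStronglyAdditive g) {n v : ℕ}
    (hv : v ∈ Finset.Icc 1 n) : g v = additivePart g (primesUpTo n) v := by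
  have h := Finset.mem_Icc.mp hv
  have hv0 : v ≠ 0 := Nat.one_le_iff_ne_zero.mp h.1
  rw [hg.eq_sum_primeFactors hv0, additivePart, ← Finset.sum_filter]
  refine Finset.sum_congr ?_ fun _ _ => rfl
  ext p
  rw [Finset.mem_filter, mem_primesUpTo, Nat.mem_primeFactors]
  exact ⟨fun hp => ⟨⟨(Nat.le_of_dvd h.1 hp.2.1).trans h.2, hp.1⟩, hp.2.1⟩,
    fun hp => ⟨hp.1.2, hp.2, hv0⟩⟩

theorem additivePart_add_sdiff (g : ℕ → ℝ) {s t : Finset ℕ} (h : s ⊆ t) (v : ℕ) :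
    additivePart g s v + additivePart g (t \ s) v = additivePart g t v := by
  rw [add_comm]
  exact Finset.sum_sdiff h

theorem integral_primeEmpiricalLaw (g : ℕ → ℝ) (n : ℕ) (φ : ℝ → ℝ) :
    ∫ y, φ y ∂primeEmpiricalLaw g n =
      (∑ p ∈ primesUpTo n, φ (g p) / p) / ∑ p ∈ primesUpTo n, (p : ℝ)⁻¹ := by
  have hne : ∀ p ∈ primesUpTo n, (p : ENNReal)⁻¹ ≠ ⊤ := fun p hp => by
    simpa using (prime_of_mem_primesUpTo hp).ne_zero
  rw [primeEmpiricalLaw, integral_smul_measure, integral_finsetSum_measure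
    fun p hp => (integrable_dirac (by simp)).smul_measure (hne p hp)]
  simp only [integral_smul_measure, integral_dirac]
  rw [ENNReal.toReal_inv, ENNReal.toReal_sum hne]
  simp only [ENNReal.toReal_inv, ENNReal.toReal_natCast, smul_eq_mul]
  rw [div_eq_inv_mul]
  simp only [div_eq_inv_mul]

theorem tendsto_sum_exp_div_log_log {g : ℕ → ℝ} {θ M : ℝ}
    (h : Tendsto (fun n => ∫ y, Real.exp (θ * y) ∂(primeEmpiricalLaw g n)) atTop (𝓝 M)) :
    Tendsto (fun n => (∑ p ∈ primesUpTo n, Real.exp (θ * g p) / p) / Real.log (Real.log n))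
      atTop (𝓝 M) := by
  have h1 := h.mul tendsto_sum_inv_div_log_log
  rw [mul_one] at h1
  refine h1.congr' ?_
  filter_upwards [tendsto_sum_inv_div_log_log.eventually_ne one_ne_zero] with n hn
  rw [integral_primeEmpiricalLaw g n fun y => Real.exp (θ * y)]
  exact div_mul_div_cancel₀ fun h0 => hn (by rw [h0, zero_div])

/-- Let X and Y be the parts of g from small and large primes. They are not independent, and only
upper bounds are known for Y; Hölder's inequality needs no more, since those bounds hold at every
tilt of either sign. -/
theorem tendsto_logMeanExp_div_log_log {g : ℕ → ℝ} (hg : IsStronglyAdditive g) {M : ℝ → ℝ}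
    (hM : Continuous M)
    (h : ∀ θ, Tendsto (fun n => (∑ p ∈ primesUpTo n, Real.exp (θ * g p) / p) /
      Real.log (Real.log n)) atTop (𝓝 (M θ))) (θ : ℝ) :
    Tendsto (fun n => logMeanExp n (fun v => θ * g v) / Real.log (Real.log n)) atTop
      (𝓝 (M θ - 1)) := by
  set X : ℕ → ℕ → ℝ := fun n => additivePart g (primesUpTo (smallPrimeBound n))
  set Y : ℕ → ℕ → ℝ := fun n => additivePart g (primesUpTo n \ primesUpTo (smallPrimeBound n))
  set r : ℝ → ℕ → ℝ := fun t n =>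
    (∑ p ∈ primesUpTo n, Real.exp (t * g p) / p) / Real.log (Real.log n) -
      (∑ p ∈ primesUpTo (smallPrimeBound n), Real.exp (t * g p) / p) / Real.log (Real.log n)
  have hr : ∀ t, Tendsto (r t) atTop (𝓝 0) := fun t => by
    simpa using (h t).sub (h t).comp_smallPrimeBound
  have hX : ∀ t, Tendsto (fun n => logMeanExp n (fun v => t * X n v) / Real.log (Real.log n))
      atTop (𝓝 (M t - 1)) := fun t => by
    -- The second moment of the weight e^{t g(p)} is its first moment at tilt 2t.
    have h2 : Tendsto (fun n => (∑ p ∈ primesUpTo n, Real.exp (t * g p) ^ 2 / p) /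
        Real.log (Real.log n)) atTop (𝓝 (M (2 * t))) := by
      refine (h (2 * t)).congr fun n => ?_
      simp only [← Real.exp_nat_mul]
      push_cast
      simp only [mul_assoc]
    refine (tendsto_log_dvdProductMean_small (fun p => Real.exp_pos _) (h t) h2).congr fun n => ?_
    rw [log_dvdProductMean_exp]
  have hY : ∀ t, ∀ᶠ n in atTop,
      logMeanExp n (fun v => t * Y n v) / Real.log (Real.log n) ≤ r t n := fun t => by
    filter_upwards [eventually_log_dvdProductMean_large_le (f := fun p => Real.exp (t * g p))
      fun p => Real.exp_pos _] with n hn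
    rwa [log_dvdProductMean_exp] at hn
  have hsplit : ∀ᶠ n in atTop, ∀ v ∈ Finset.Icc 1 n, g v = X n v + Y n v := by
    filter_upwards [eventually_smallPrimeBound_le] with n hn v hv
    rw [hg.eq_additivePart hv]
    exact (additivePart_add_sdiff g (fun p hp => mem_primesUpTo.mpr
      ⟨(le_of_mem_primesUpTo hp).trans hn, prime_of_mem_primesUpTo hp⟩) v).symm
  have hexp : ∀ {P : ℝ → Prop}, (∀ᶠ p in 𝓝 (1 : ℝ), P p) → ∃ p, 1 < p ∧ P p := fun {P} hP =>
    ((hP.filter_mono nhdsWithin_le_nhds : ∀ᶠ p in 𝓝[>] (1 : ℝ), P p).and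
      self_mem_nhdsWithin).exists.imp fun _ hp => ⟨hp.2, hp.1⟩
  rw [tendsto_order]
  constructor
  · intro a ha
    -- Lower bound: apply Hölder to p⁻¹θX = p⁻¹θg - p⁻¹θY, so that g appears on the larger side with
    -- tilt exactly θ, then let p decrease to 1.
    obtain ⟨p, hp1, hpa⟩ := hexp (P := fun p => a < p * (M (p⁻¹ * θ) - 1)) (by
      have hc : ContinuousAt (fun p : ℝ => p * (M (p⁻¹ * θ) - 1)) 1 := by
        refine continuousAt_id.mul (ContinuousAt.sub (hM.continuousAt.comp ?_) continuousAt_const)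
        exact (continuousAt_inv₀ one_ne_zero).mul continuousAt_const
      exact hc.eventually_const_lt (by simpa using ha))
    have hp0 : 0 < p := by linarith
    have hpq := Real.HolderConjugate.conjExponent hp1
    set q := p.conjExponent
    have hlim : Tendsto (fun n => p * (logMeanExp n (fun v => p⁻¹ * θ * X n v) /
        Real.log (Real.log n) - r (q * -(p⁻¹ * θ)) n / q)) atTop
        (𝓝 (p * (M (p⁻¹ * θ) - 1))) := by
      simpa using ((hX (p⁻¹ * θ)).sub ((hr (q * -(p⁻¹ * θ))).div_const q)).const_mul p
    filter_upwards [hlim.eventually_const_lt hpa, hY (q * -(p⁻¹ * θ)), hsplit,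
      eventually_gt_atTop 0, tendsto_log_log_nat_atTop.eventually_gt_atTop 0]
      with n h1 h2 h3 h4 h5
    refine h1.trans_le ?_
    have h6 := logMeanExp_add_le h4 (fun v => p⁻¹ * θ * g v) (fun v => -(p⁻¹ * θ) * Y n v) hpq
    rw [logMeanExp_congr (n := n) (ψ := fun v => p⁻¹ * θ * X n v)
      fun v hv => by rw [h3 v hv]; ring] at h6
    have e1 : (fun v => p * (p⁻¹ * θ * g v)) = fun v => θ * g v := by
      funext v
      field_simp
    have e2 : (fun v => q * (-(p⁻¹ * θ) * Y n v)) = fun v => q * -(p⁻¹ * θ) * Y n v := by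
      funext v
      ring
    rw [e1, e2] at h6
    have h7 := div_le_div_of_nonneg_right h6 h5.le
    rw [add_div, div_right_comm, div_right_comm _ q] at h7
    have h8 := div_le_div_of_nonneg_right h2 hpq.symm.pos.le
    rw [← le_div_iff₀' hp0]
    linarith
  · intro c hc
    -- Upper bound: apply Hölder directly to θg = θX + θY.
    obtain ⟨p, hp1, hpc⟩ := hexp (P := fun p => (M (p * θ) - 1) / p < c) (by
      have hcont : ContinuousAt (fun p : ℝ => (M (p * θ) - 1) / p) 1 := by
        refine ContinuousAt.div ?_ continuousAt_id one_ne_zero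
        exact (by fun_prop : Continuous fun p : ℝ => M (p * θ) - 1).continuousAt
      exact hcont.eventually_lt_const (by simpa using hc))
    have hpq := Real.HolderConjugate.conjExponent hp1
    set q := p.conjExponent
    have hlim : Tendsto (fun n => logMeanExp n (fun v => p * θ * X n v) /
        Real.log (Real.log n) / p + r (q * θ) n / q) atTop (𝓝 ((M (p * θ) - 1) / p)) := by
      simpa using ((hX (p * θ)).div_const p).add ((hr (q * θ)).div_const q)
    filter_upwards [hlim.eventually_lt_const hpc, hY (q * θ), hsplit,
      eventually_gt_atTop 0, tendsto_log_log_nat_atTop.eventually_gt_atTop 0]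
      with n h1 h2 h3 h4 h5
    refine lt_of_le_of_lt ?_ h1
    have h6 := logMeanExp_add_le h4 (fun v => θ * X n v) (fun v => θ * Y n v) hpq
    rw [logMeanExp_congr (n := n) (ψ := fun v => θ * g v)
      fun v hv => by rw [h3 v hv]; ring] at h6
    simp only [← mul_assoc] at h6
    have h7 := div_le_div_of_nonneg_right h6 h5.le
    rw [add_div, div_right_comm, div_right_comm _ q] at h7
    have h8 := div_le_div_of_nonneg_right h2 hpq.symm.pos.le
    linarith

/-! ### Cumulant generating functions of the scaled laws -/

theorem integrable_uniformOn_finset (s : Finset ℕ) (φ : ℕ → ℝ) :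
    Integrable φ (uniformOn (s : Set ℕ)) := by
  rcases s.eq_empty_or_nonempty with rfl | hs
  · simp
  have hprob := isProbabilityMeasure_uniformOn s.finite_toSet hs
  have h := IntegrableOn.finset (μ := uniformOn (s : Set ℕ)) (s := s) (f := φ)
  rwa [IntegrableOn, uniformOn, ProbabilityTheory.cond, Measure.restrict_smul,
    Measure.restrict_restrict s.measurableSet, Set.inter_self] at h

theorem integral_uniformOn_finset (s : Finset ℕ) (φ : ℕ → ℝ) :
    ∫ v, φ v ∂uniformOn (s : Set ℕ) = (∑ v ∈ s, φ v) / s.card := by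
  rcases s.eq_empty_or_nonempty with rfl | hs
  · simp
  have h := integrable_uniformOn_finset s φ
  have hcard : Measure.count (s : Set ℕ) = s.card := Measure.count_apply_finset s
  rw [uniformOn, ProbabilityTheory.cond, hcard] at h ⊢
  rw [integrable_smul_measure (by simp) (by simpa using hs.ne_empty)] at h
  rw [integral_smul_measure, setIntegral_finset _ h]
  simp [Measure.real, div_eq_inv_mul]

theorem scaledLaw_eq (g : ℕ → ℝ) (n : ℕ) :
    scaledLaw g n = (uniformOn ((Finset.Icc 1 n : Finset ℕ) : Set ℕ)).map
      fun v : ℕ => g v / Real.log (Real.log n) := by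
  rw [scaledLaw, Finset.coe_Icc]

theorem isProbabilityMeasure_scaledLaw (g : ℕ → ℝ) {n : ℕ} (hn : 0 < n) :
    IsProbabilityMeasure (scaledLaw g n) := by
  have := isProbabilityMeasure_uniformOn (Set.finite_Icc 1 n) (Set.nonempty_Icc.mpr hn)
  exact Measure.isProbabilityMeasure_map (measurable_of_countable _).aemeasurable

theorem integrable_exp_scaledLaw (g : ℕ → ℝ) (n : ℕ) (t : ℝ) :
    Integrable (fun x : ℝ => Real.exp (t * x)) (scaledLaw g n) := by
  rw [scaledLaw_eq, integrable_map_measure (by fun_prop)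
    (measurable_of_countable _).aemeasurable]
  exact integrable_uniformOn_finset _ _

theorem cgf_scaledLaw (g : ℕ → ℝ) {n : ℕ} (hL : Real.log (Real.log n) ≠ 0) (θ : ℝ) :
    cgf id (scaledLaw g n) (Real.log (Real.log n) * θ) = logMeanExp n fun v => θ * g v := by
  rw [cgf, logMeanExp, scaledLaw_eq, mgf_id_map (measurable_of_countable _).aemeasurable, mgf,
    integral_uniformOn_finset, Nat.card_Icc, Nat.add_sub_cancel]
  congr 2
  refine Finset.sum_congr rfl fun v _ => ?_
  congr 1
  field_simp

end

/-! ### The large deviation principle -/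

theorem theorem1 (g : ℕ → ℝ) (hg : IsStronglyAdditive g)
    (ρ : Measure ℝ) (hρ : IsProbabilityMeasure ρ)
    (hρ_mgf : ∀ θ : ℝ, Integrable (fun y : ℝ => Real.exp (θ * y)) ρ)
    (hconv : ∀ θ : ℝ,
      Tendsto (fun n : ℕ => ∫ y, Real.exp (θ * y) ∂(primeEmpiricalLaw g n)) atTop
        (𝓝 (∫ y, Real.exp (θ * y) ∂ρ))) :
    SatisfiesLDP (scaledLaw g) (fun n : ℕ => Real.log (Real.log n)) (rateFunction ρ) := by
  have hset : interior (integrableExpSet id ρ) = Set.univ := by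
    rw [Set.eq_univ_of_forall (s := integrableExpSet id ρ) hρ_mgf, interior_univ]
  have hdiff : Differentiable ℝ (mgf id ρ) := fun θ =>
    differentiableAt_mgf (by rw [hset]; trivial)
  have hmgf : ∀ θ, ∫ y, (Real.exp (θ * y) - 1) ∂ρ = mgf id ρ θ - 1 := fun θ => by
    rw [integral_sub (hρ_mgf θ) (integrable_const 1)]
    simp [mgf]
  have hid : Integrable id ρ :=
    integrable_of_mem_interior_integrableExpSet (by rw [hset]; trivial)
  have hlim := tendsto_logMeanExp_div_log_log hg (M := mgf id ρ) hdiff.continuous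
    fun θ => tendsto_sum_exp_div_log_log (hconv θ)
  refine satisfiesLDP_of_tendsto_cgf (Λ := fun θ => ∫ y, (Real.exp (θ * y) - 1) ∂ρ)
    (m := ∫ y, y ∂ρ) ?_ tendsto_log_log_nat_atTop (integrable_exp_scaledLaw g) (by simp) ?_ ?_ ?_
  · filter_upwards [eventually_gt_atTop 0] with n hn
    exact isProbabilityMeasure_scaledLaw g hn
  · simp only [hmgf]
    exact hdiff.sub_const 1
  -- The tangent line at 0 comes from integrating θy ≤ e^{θy} - 1 against ρ.
  · intro θ
    rw [mul_comm, ← integral_const_mul]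
    exact integral_mono (hid.const_mul θ) ((hρ_mgf θ).sub (integrable_const 1))
      fun y => by linarith [Real.add_one_le_exp (θ * y)]
  · intro θ
    simp only [hmgf]
    refine (hlim θ).congr' ?_
    filter_upwards [tendsto_log_log_nat_atTop.eventually_ne_atTop 0] with n hn
    rw [cgf_scaledLaw g hn]
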